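/- Let $\mathbb{D}$ be the open unit disc in $\mathbb{C}$ and let $H(\mathbb{D})$ be the space of holomorphic functions on $\mathbb{D}$. For $p\in(0,\infty)$ and $\alpha>-1$ let $A^p_\alpha$ be the weighted Bergman space of all $f\in H(\mathbb{D})$ with $$\|f\|_{p,\alpha}^p=\int_{\mathbb{D}}|f(z)|^p(1+\alpha)(1-|z|^2)^\alpha\,\frac{dx\,dy}{\pi}<\infty ,$$ and let $A^p_{-1}=H^p$ be the Hardy space of all $f\in H(\mathbb{D})$ with $\|f\|_{p,-1}^p=\sup_{0\le r<1}\frac1{2\pi}\int_0^{2\pi}|f(re^{i\theta})|^p\,d\theta<\infty$. Let $H^\infty$ be the space of bounded holomorphic functions on $\mathbb{D}$ with the supremum norm $\|\cdot\|_\infty$. Theorem. Let $p\in(0,\infty)$, let $\alpha\in[-1,\infty)$ and let $n$ be a positive integer. Let $u_0,\dots,u_n\in H(\mathbb{D})$, let $\varphi_0,\dots,\varphi_n$ be holomorphic self-maps of $\mathbb{D}$, and let $$Tf=\sum_{k=0}^n D^k_{u_k,\varphi_k}f,\qquad D^k_{u_k,\varphi_k}f=u_k\cdot(f^{(k)}\circ\varphi_k).$$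 The following are equivalent. (a) $T$ is a compact operator from $A^p_\alpha$ to $H^\infty$, that is, $T$ maps $A^p_\alpha$ into $H^\infty$ and maps bounded subsets of $A^p_\alpha$ to relatively compact subsets of $H^\infty$. (b) For every bounded sequence $(f_j)$ in $A^p_\alpha$ that converges to $0$ uniformly on compact subsets of $\mathbb{D}$, $\|Tf_j\|_\infty=\sup_{z\in\mathbb{D}}|Tf_j(z)|$ (a value in $[0,\infty]$) tends to $0$ as $j\to\infty$. (c) For each $0\le k\le n$, $u_k\in H^\infty$ and $$\lim_{|\varphi_k(z)|\to1}\frac{|u_k(z)|}{(1-|\varphi_k(z)|^2)^{\frac{2+\alpha}{p}+k}}=0,$$ that is, for every $\varepsilon>0$ there is $\delta<1$ such that the quotient is less than $\varepsilon$ for all $z\in\mathbb{D}$ with $|\varphi_k(z)|>\delta$ (which holds trivially if $\sup_{\mathbb{D}}|\varphi_k|<1$). (d) For each $0\le k\le n$ the summand $D^k_{u_k,\varphi_k}$ is a compact operator from $A^p_\alpha$ to $H^\infty$. -/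

import Mathlib

open Set Filter Topology MeasureTheory
open scoped ENNReal NNReal BoundedContinuousFunction

noncomputable section

/-- The open unit disc `{z : |z| < 1}` in `ℂ`. -/
abbrev disc : Set ℂ := Metric.ball (0 : ℂ) 1

/-- The probability measure `dA_α(z) = (1 + α) (1 - |z|²)^α dA(z)` on the disc (for `α > -1`),
where `dA = dx dy / π`. -/
def bergmanMeasure (α : ℝ) : Measure ℂ :=
  (volume.restrict disc).withDensity
    fun z => ENNReal.ofReal ((1 + α) * (1 - ‖z‖ ^ 2) ^ α / Real.pi)

/-- Normalized Lebesgue measure `dθ / 2π` on `(0, 2π]`. -/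
def angleMeasure : Measure ℝ :=
  ENNReal.ofReal (2 * Real.pi)⁻¹ • volume.restrict (Ioc 0 (2 * Real.pi))

/-- The Hardy space (quasi-)norm
`sup_{0 ≤ r < 1} ((2π)⁻¹ ∫₀^{2π} |f (r e^{iθ})|^p dθ)^{1/p}`, with values in `[0, ∞]`. -/
def hardyNorm (p : ℝ) (f : ℂ → ℂ) : ℝ≥0∞ :=
  ⨆ r ∈ Ico (0 : ℝ) 1, eLpNorm (fun θ : ℝ => f (circleMap 0 r θ)) (ENNReal.ofReal p) angleMeasure

/-- The (quasi-)norm `‖f‖_{p,α}`, with values in `[0, ∞]`: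
`(∫ |f|^p dA_α)^{1/p}` for `α > -1`, and the Hardy space (quasi-)norm for `α = -1`. -/
def bergmanNorm (p α : ℝ) (f : ℂ → ℂ) : ℝ≥0∞ :=
  if α = -1 then hardyNorm p f else eLpNorm f (ENNReal.ofReal p) (bergmanMeasure α)

/-- `f` represents an element of `A^p_α`: it is holomorphic on the disc with finite (quasi-)norm.
Only the values of `f` on the disc matter. -/
def MemBergman (p α : ℝ) (f : ℂ → ℂ) : Prop :=
  DifferentiableOn ℂ f disc ∧ bergmanNorm p α f < ∞

/-- The supremum norm `sup_{z ∈ 𝔻} |g z|`, with values in `[0, ∞]`. -/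
def supNorm (g : ℂ → ℂ) : ℝ≥0∞ := ⨆ z ∈ disc, ‖g z‖ₑ

/-- `g` represents an element of `H^∞`: it is holomorphic and bounded on the disc. -/
def MemHInfty (g : ℂ → ℂ) : Prop :=
  DifferentiableOn ℂ g disc ∧ supNorm g < ∞

/-- The normed space `H^∞` of bounded holomorphic functions on the disc with the supremum norm,
as a subspace of the bounded continuous functions on the disc. -/
def HInfty : Submodule ℂ (disc →ᵇ ℂ) where
  carrier := {g | ∃ G : ℂ → ℂ, DifferentiableOn ℂ G disc ∧ ∀ z : disc, g z = G z}
  add_mem' := by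
    rintro a b ⟨A, hA, ha⟩ ⟨B, hB, hb⟩
    exact ⟨fun z => A z + B z, hA.add hB, fun z => by simp [ha, hb]⟩
  zero_mem' := ⟨fun _ => 0, differentiableOn_const _, fun _ => rfl⟩
  smul_mem' := by
    rintro c a ⟨A, hA, ha⟩
    exact ⟨fun z => c * A z, hA.const_mul c, fun z => by simp [ha]⟩

/-- `T : A^p_α → H^∞` is a (well defined) compact operator: it maps `A^p_α` into `H^∞`, and the
image of every norm-bounded subset of `A^p_α` is relatively compact in `H^∞`. -/
def IsCompactBergmanToHInfty (p α : ℝ) (T : (ℂ → ℂ) → ℂ → ℂ) : Prop :=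
  (∀ f, MemBergman p α f → MemHInfty (T f)) ∧
  ∀ M : ℝ≥0, IsCompact (closure
    {g : HInfty | ∃ f, MemBergman p α f ∧ bergmanNorm p α f ≤ M ∧
      ∀ z : disc, (g : disc →ᵇ ℂ) z = T f z})

/-- The generalized weighted composition operator `D^k_{u,φ} f = u · (f^{(k)} ∘ φ)`. -/
def weightedDiffComp (k : ℕ) (u φ : ℂ → ℂ) (f : ℂ → ℂ) : ℂ → ℂ :=
  fun z => u z * iteratedDeriv k f (φ z)

/-- The operator `T^n_{u;φ} = ∑_{k=0}^n D^k_{u_k,φ_k}`. -/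
def sumWeightedDiffComp (n : ℕ) (u φ : Fin (n + 1) → ℂ → ℂ) (f : ℂ → ℂ) : ℂ → ℂ :=
  fun z => ∑ k : Fin (n + 1), weightedDiffComp k (u k) (φ k) f z

/-- The filter `|φ(z)| → 1` on the points `z` of the disc. -/
def towardBoundary (φ : ℂ → ℂ) : Filter ℂ :=
  comap (fun z => ‖φ z‖) (𝓝 1) ⊓ 𝓟 disc

end

/-! Write γ = (2 + α)/p. For f in a ball of `A^p_α`, the k-th derivative at w is O((1 -
|w|)^(-γ-k)): |f|^p is subharmonic, which bounds f by area means, and Cauchy's estimate adds one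
power per derivative. Under (c) this makes u_k · (f^(k) ∘ φ_k) uniformly small where |φ_k| is close
to 1. Where |φ_k| ≤ δ, the derivatives f^(k) are uniformly bounded and Lipschitz, so finitely many
values describe them up to ε. Hence each summand is compact (`isCompact_weightedDiffComp`), and so
is the sum. That (a) gives (b) is a subsequence argument.

The substance is (b) ⇒ (c): the summands cannot cancel each other. Monomials show by induction that
every u_k is bounded. For the decay, let x_a(w) = (1 - |a|²)/(1 - ā w), so that x_a' = (ā/(1 -
|a|²)) x_a². Then the j-th derivative of P(x_a) is (ā/(1 - |a|²))^j (D^j P)(x_a) with D = X² d/dX,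
and derivatives of test functions become polynomial algebra. If P vanishes to high order at 0, the
functions (1 - |a|²)^(-γ) P(x_a) are bounded in `A^p_α` and tend to 0 locally uniformly as |a| → 1.

If (c) fails, take an ultrafilter along which one quotient in (c) stays above ε, and let k be the
index whose quotient dominates the others (`exists_dominant_quotient`). With a = φ_k(z), each
x_a(φ_j(z)) is bounded by 2 and has a limit ξ_j. There is one polynomial P with (D^j P)(ξ_j) = 0 for
all j ≠ k and (D^k P)(1) ≠ 0 (`exists_polynomial_sqDerivative_eval`). Since x_a(a) = 1, the k-th
term survives while the others are negligible against it, which contradicts (b). -/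

section

open scoped ComplexConjugate Polynomial

/-! ### Subharmonicity of |f|^p -/

/-- Jensen's inequality for an analytic function: `log |f|` is subharmonic. -/
theorem log_norm_le_circleAverage {f : ℂ → ℂ} {c : ℂ} {R : ℝ} (hR : 0 < R)
    (hf : AnalyticOnNhd ℂ f (Metric.closedBall c R)) (hc : f c ≠ 0) :
    Real.log ‖f c‖ ≤ Real.circleAverage (fun z => Real.log ‖f z‖) c R := by
  have hf' : AnalyticOnNhd ℂ f (Metric.closedBall c |R|) := by rwa [abs_of_pos hR]
  rw [hf'.circleAverage_log_norm hR.ne' hc, le_add_iff_nonneg_left]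
  refine finsum_nonneg fun u => ?_
  by_cases hu : u ∈ Metric.closedBall c |R|
  · refine mul_nonneg (mod_cast MeromorphicOn.AnalyticOnNhd.divisor_nonneg hf' u) ?_
    by_cases huc : u = c
    · simp [huc]
    · apply Real.log_nonneg
      rw [← div_eq_mul_inv, one_le_div (norm_pos_iff.2 (sub_ne_zero.2 (Ne.symm huc)))]
      rw [Metric.mem_closedBall, dist_comm, dist_eq_norm, abs_of_pos hR] at hu
      exact hu
  · simp [hu]

theorem Real.log_le_div_exp_one {x : ℝ} (hx : 0 ≤ x) : Real.log x ≤ x / Real.exp 1 := by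
  rcases hx.eq_or_lt with rfl | hx
  · simp
  · have := Real.log_le_sub_one_of_pos (x := x / Real.exp 1) (by positivity)
    rw [Real.log_div hx.ne' (Real.exp_pos 1).ne', Real.log_exp] at this
    linarith

/-- `|f|^p` is subharmonic for every `p > 0`. -/
theorem rpow_norm_le_circleAverage {f : ℂ → ℂ} {c : ℂ} {R p : ℝ} (hR : 0 < R) (hp : 0 < p)
    (hf : AnalyticOnNhd ℂ f (Metric.closedBall c R)) :
    ‖f c‖ ^ p ≤ Real.circleAverage (fun z => ‖f z‖ ^ p) c R := by
  have hnn : 0 ≤ Real.circleAverage (fun z => ‖f z‖ ^ p) c R :=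
    Real.circleAverage_nonneg_of_nonneg fun x _ => by positivity
  by_cases hc : f c = 0
  · simpa [hc, Real.zero_rpow hp.ne'] using hnn
  refine le_of_forall_gt_imp_ge_of_dense fun A hA => ?_
  have hA0 : 0 < A := hnn.trans_lt hA
  have hfc : 0 < ‖f c‖ := norm_pos_iff.2 hc
  have hcont : ContinuousOn f (Metric.sphere c |R|) := by
    rw [abs_of_pos hR]; exact hf.continuousOn.mono Metric.sphere_subset_closedBall
  have hi2 : CircleIntegrable (fun z => ‖f z‖ ^ p) c R :=
    ContinuousOn.circleIntegrable' (hcont.norm.rpow_const fun x _ => Or.inr hp.le)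
  -- The line `log x ≤ x / e` is tangent at x = e. This scaling turns it into p log |s f| ≤ |f|^p /
  -- A, whose mean is at most 1/A · A = 1; then Jensen gives s^p |f c|^p ≤ e, that is |f c|^p ≤ A.
  set s : ℝ := (Real.exp 1 / A) ^ p⁻¹ with hs
  have hs0 : 0 < s := by positivity
  have hsp : s ^ p = Real.exp 1 / A := Real.rpow_inv_rpow (by positivity) hp.ne'
  have hg : AnalyticOnNhd ℂ (fun z => (s : ℂ) * f z) (Metric.closedBall c R) :=
    fun z hz => analyticAt_const.mul (hf z hz)
  have hgn (z : ℂ) : ‖(s : ℂ) * f z‖ = s * ‖f z‖ := by simp [abs_of_pos hs0]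
  have hgp (z : ℂ) : p * Real.log ‖(s : ℂ) * f z‖ ≤ ‖f z‖ ^ p / A := by
    have h1 : p * Real.log ‖(s : ℂ) * f z‖ ≤ ‖(s : ℂ) * f z‖ ^ p / Real.exp 1 := by
      rcases (norm_nonneg ((s : ℂ) * f z)).eq_or_lt with h0 | h0
      · rw [← h0]; simp [Real.zero_rpow hp.ne']
      · rw [← Real.log_rpow h0]; exact Real.log_le_div_exp_one (by positivity)
    refine h1.trans_eq ?_
    rw [hgn, Real.mul_rpow hs0.le (norm_nonneg _), hsp]
    field_simp
  have h1 := log_norm_le_circleAverage hR hg (mul_ne_zero (by exact_mod_cast hs0.ne') hc)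
  have hi1 : CircleIntegrable (fun z => Real.log ‖(s : ℂ) * f z‖) c R := by
    apply MeromorphicOn.circleIntegrable_log_norm
    rw [abs_of_pos hR]
    exact (hg.mono Metric.sphere_subset_closedBall).meromorphicOn
  have h2 : Real.circleAverage (fun z => Real.log ‖(s : ℂ) * f z‖) c R
      ≤ Real.circleAverage (fun z => (p * A)⁻¹ • ‖f z‖ ^ p) c R := by
    refine Real.circleAverage_mono hi1 (IntervalIntegrable.const_mul hi2 _) fun z _ => ?_
    have := hgp z
    rw [smul_eq_mul, inv_mul_eq_div, le_div_iff₀ (by positivity)]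
    rw [le_div_iff₀ hA0] at this
    linarith
  rw [Real.circleAverage_fun_smul] at h2
  have h3 : Real.log ‖(s : ℂ) * f c‖ ≤ p⁻¹ := by
    refine (h1.trans h2).trans ?_
    rw [smul_eq_mul, mul_inv, mul_assoc]
    refine mul_le_of_le_one_right (by positivity) ?_
    rw [inv_mul_le_iff₀ hA0]; linarith
  rw [hgn, Real.log_le_iff_le_exp (by positivity)] at h3
  have h4 := Real.rpow_le_rpow (by positivity) h3 hp.le
  rw [Real.mul_rpow hs0.le hfc.le, hsp, ← Real.exp_mul, inv_mul_cancel₀ hp.ne',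
    div_mul_eq_mul_div, div_le_iff₀ hA0] at h4
  exact le_of_mul_le_mul_left h4 (Real.exp_pos 1)

/-! ### Rotation averages and area means -/

theorem angleMeasure_eq : angleMeasure =
    ENNReal.ofReal (2 * Real.pi)⁻¹ • volume.restrict (Ioc 0 (2 * Real.pi)) := rfl

instance : IsProbabilityMeasure angleMeasure := by
  refine ⟨?_⟩
  rw [angleMeasure_eq, Measure.smul_apply, Measure.restrict_apply_univ, Real.volume_Ioc, sub_zero,
    smul_eq_mul, ← ENNReal.ofReal_mul (by positivity), inv_mul_cancel₀ (by positivity),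
    ENNReal.ofReal_one]

theorem lintegral_angleMeasure_eq {g : ℂ → ℝ} {c : ℂ} {R : ℝ} (hg : ∀ z, 0 ≤ g z)
    (hc : ContinuousOn g (Metric.sphere c |R|)) :
    ∫⁻ θ, ENNReal.ofReal (g (circleMap c R θ)) ∂angleMeasure
      = ENNReal.ofReal (Real.circleAverage g c R) := by
  have hi : CircleIntegrable g c R := hc.circleIntegrable'
  rw [Real.circleAverage_def, angleMeasure_eq, lintegral_smul_measure, smul_eq_mul, smul_eq_mul,
    ENNReal.ofReal_mul (by positivity),
    intervalIntegral.integral_of_le Real.two_pi_pos.le, ofReal_integral_eq_lintegral_ofReal]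
  · exact (intervalIntegrable_iff_integrableOn_Ioc_of_le Real.two_pi_pos.le).1 hi
  · exact .of_forall fun _ => hg _

theorem enorm_rpow_eq_ofReal {p : ℝ} (hp : 0 < p) (z : ℂ) : ‖z‖ₑ ^ p = ENNReal.ofReal (‖z‖ ^ p) := by
  rw [← ofReal_norm, ENNReal.ofReal_rpow_of_nonneg (norm_nonneg _) hp.le]

/-- The mean over the rotations of `w` is the mean over the circle of radius `|w|`. -/
theorem circleAverage_rotate {E : Type*} [NormedAddCommGroup E] [NormedSpace ℝ E] (g : ℂ → E)
    (w : ℂ) : Real.circleAverage (fun ζ => g (ζ * w)) 0 1 = Real.circleAverage g 0 ‖w‖ := by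
  rw [Real.circleAverage_eq_integral_add (f := g) (R := ‖w‖) w.arg, Real.circleAverage_def]
  congr 2
  ext θ
  congr 1
  have hw := Complex.norm_mul_exp_arg_mul_I w
  simp only [circleMap, zero_add, Complex.ofReal_one, one_mul, Complex.ofReal_add, add_mul,
    Complex.exp_add]
  linear_combination (-Complex.exp (θ * Complex.I)) * hw

/-- Averaging an integral over the plane over all rotations. -/
theorem lintegral_eq_lintegral_rotate {G : ℂ → ℝ≥0∞} (hG : Measurable G) :
    ∫⁻ v, G v = ∫⁻ v, ∫⁻ θ, G (circleMap 0 1 θ * v) ∂angleMeasure := by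
  have hrot (θ : ℝ) : ∫⁻ v, G (circleMap 0 1 θ * v) = ∫⁻ v, G v := by
    have h := (rotation (Circle.exp θ)).measurePreserving.lintegral_comp hG
    simpa [rotation_apply, Circle.coe_exp, circleMap] using h
  rw [lintegral_lintegral_swap]
  · simp [hrot]
  · refine (hG.comp ?_).aemeasurable
    exact (((continuous_circleMap 0 1).comp continuous_snd).mul continuous_fst).measurable

theorem measurable_indicator_rpow {f : ℂ → ℂ} {S : Set ℂ} {p : ℝ} (hS : MeasurableSet S)
    (hf : ContinuousOn f S) : Measurable (S.indicator fun w => ‖f w‖ₑ ^ p) := by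
  classical
  have h : Measurable (S.piecewise f 0) := hf.measurable_piecewise continuousOn_const hS
  have : (S.indicator fun w => ‖f w‖ₑ ^ p) = S.indicator fun w => ‖S.piecewise f 0 w‖ₑ ^ p := by
    ext w
    by_cases hw : w ∈ S <;> simp [hw]
  rw [this]
  exact (h.enorm.pow_const p).indicator hS

/-- The area mean value inequality for `|f|^p`. -/
theorem rpow_mul_volume_ball_le {f : ℂ → ℂ} {z : ℂ} {ρ p : ℝ} (hp : 0 < p)
    (hf : DifferentiableOn ℂ f (Metric.ball z ρ)) :
    ‖f z‖ₑ ^ p * volume (Metric.ball z ρ) ≤ ∫⁻ w in Metric.ball z ρ, ‖f w‖ₑ ^ p := by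
  set F : ℂ → ℝ≥0∞ := (Metric.ball z ρ).indicator fun w => ‖f w‖ₑ ^ p with hF
  have hFm : Measurable F := measurable_indicator_rpow Metric.isOpen_ball.measurableSet hf.continuousOn
  rw [← lintegral_indicator Metric.isOpen_ball.measurableSet, ← hF,
    ← lintegral_add_left_eq_self F z,
    lintegral_eq_lintegral_rotate (G := fun v => F (z + v)) (by fun_prop),
    ← lintegral_add_left_eq_self _ (-z),
    ← setLIntegral_const]
  rw [← lintegral_indicator Metric.isOpen_ball.measurableSet]
  refine lintegral_mono fun w => ?_
  by_cases hw : w ∈ Metric.ball z ρ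
  swap
  · rw [indicator_of_notMem hw]; exact zero_le
  rw [indicator_of_mem hw]
  have hin (ζ : ℂ) (hζ : ‖ζ‖ ≤ 1) : z + ζ * (-z + w) ∈ Metric.ball z ρ := by
    rw [Metric.mem_ball, dist_eq_norm] at hw ⊢
    rw [add_sub_cancel_left, norm_mul, neg_add_eq_sub]
    exact (mul_le_of_le_one_left (norm_nonneg _) hζ).trans_lt hw
  -- For fixed w, ζ = 0 gives f z and |ζ| = 1 gives the rotations of w about z, so the submean value
  -- property bounds |f z|^p by the mean of |f|^p over these rotations.
  have hd : AnalyticOnNhd ℂ (fun ζ => f (z + ζ * (-z + w))) (Metric.closedBall 0 1) := by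
    intro ζ hζ
    have h1 : AnalyticAt ℂ f (z + ζ * (-z + w)) :=
      hf.analyticAt (Metric.isOpen_ball.mem_nhds (hin ζ (by simpa using hζ)))
    exact h1.comp (f := fun ζ => z + ζ * (-z + w)) (by fun_prop)
  have h1 := rpow_norm_le_circleAverage one_pos hp hd
  have h2 := lintegral_angleMeasure_eq (g := fun ζ => ‖f (z + ζ * (-z + w))‖ ^ p) (c := 0) (R := 1)
    (fun _ => by positivity) (by
      rw [abs_one]
      exact (hd.continuousOn.mono Metric.sphere_subset_closedBall).norm.rpow_const
        fun x _ => Or.inr hp.le)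
  calc ‖f z‖ₑ ^ p ≤ ENNReal.ofReal
        (Real.circleAverage (fun ζ => ‖f (z + ζ * (-z + w))‖ ^ p) 0 1) := by
        rw [enorm_rpow_eq_ofReal hp]
        simpa using ENNReal.ofReal_le_ofReal h1
    _ = _ := by
        rw [← h2]
        refine lintegral_congr fun θ => ?_
        simp only [hF]
        rw [indicator_of_mem (hin _ (by simp)), enorm_rpow_eq_ofReal hp]

theorem eLpNorm_rpow_eq_lintegral {X : Type*} [MeasurableSpace X] {μ : Measure X} {f : X → ℂ}
    {p : ℝ} (hp : 0 < p) : eLpNorm f (ENNReal.ofReal p) μ ^ p = ∫⁻ x, ‖f x‖ₑ ^ p ∂μ := by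
  rw [eLpNorm_eq_lintegral_rpow_enorm_toReal (by simpa using hp) ENNReal.ofReal_ne_top,
    ENNReal.toReal_ofReal hp.le, ← ENNReal.rpow_mul, one_div, inv_mul_cancel₀ hp.ne',
    ENNReal.rpow_one]

theorem eLpNorm_le_iff_lintegral {X : Type*} [MeasurableSpace X] {μ : Measure X} {f : X → ℂ}
    {p : ℝ} (hp : 0 < p) {M : ℝ≥0∞} :
    eLpNorm f (ENNReal.ofReal p) μ ≤ M ↔ ∫⁻ x, ‖f x‖ₑ ^ p ∂μ ≤ M ^ p := by
  rw [← eLpNorm_rpow_eq_lintegral hp, ENNReal.rpow_le_rpow_iff hp]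

/-! ### Point evaluations on Hardy and Bergman spaces -/

/-- The circle means of `|f|^p` are bounded by the Hardy norm. -/
theorem circleAverage_le_hardyNorm {f : ℂ → ℂ} {p : ℝ} (hp : 0 < p)
    (hf : ContinuousOn f disc) {r : ℝ} (hr : 0 ≤ r) (hr1 : r < 1) :
    ENNReal.ofReal (Real.circleAverage (fun z => ‖f z‖ ^ p) 0 r) ≤ hardyNorm p f ^ p := by
  have h1 : eLpNorm (fun θ : ℝ => f (circleMap 0 r θ)) (ENNReal.ofReal p) angleMeasure
      ≤ hardyNorm p f := le_iSup₂_of_le r ⟨hr, hr1⟩ le_rfl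
  rw [eLpNorm_le_iff_lintegral hp] at h1
  rw [← lintegral_angleMeasure_eq (fun _ => by positivity)]
  · simpa only [enorm_rpow_eq_ofReal hp] using h1
  · refine (hf.mono fun z hz => ?_).norm.rpow_const fun x _ => Or.inr hp.le
    rw [abs_of_nonneg hr] at hz
    simp only [mem_sphere_iff_norm, sub_zero] at hz
    simpa [hz] using hr1

/-- Integrals of `|f|^p` over rotation invariant sets are controlled by the Hardy norm. -/
theorem setLIntegral_le_hardyNorm {f : ℂ → ℂ} {p : ℝ} (hp : 0 < p) (hf : ContinuousOn f disc)
    {S : Set ℝ} (hS : MeasurableSet S) (hS1 : S ⊆ Iio 1) :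
    ∫⁻ w in {w : ℂ | ‖w‖ ∈ S}, ‖f w‖ₑ ^ p ≤ hardyNorm p f ^ p * volume {w : ℂ | ‖w‖ ∈ S} := by
  have hSm : MeasurableSet {w : ℂ | ‖w‖ ∈ S} := measurable_norm hS
  have hsub : {w : ℂ | ‖w‖ ∈ S} ⊆ disc := fun w hw => by simpa using hS1 hw
  rw [← lintegral_indicator hSm,
    lintegral_eq_lintegral_rotate (measurable_indicator_rpow hSm (hf.mono hsub)),
    ← setLIntegral_const, ← lintegral_indicator hSm]
  refine lintegral_mono fun w => ?_
  by_cases hw : w ∈ {w : ℂ | ‖w‖ ∈ S}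
  · rw [indicator_of_mem (f := fun _ => hardyNorm p f ^ p) hw]
    refine le_trans (le_of_eq ?_) (circleAverage_le_hardyNorm hp hf (norm_nonneg w) (hS1 hw))
    rw [← circleAverage_rotate (fun z => ‖f z‖ ^ p), ← lintegral_angleMeasure_eq]
    · refine lintegral_congr fun θ => ?_
      rw [indicator_of_mem (by simpa using hw), enorm_rpow_eq_ofReal hp]
    · intro z; positivity
    · refine ContinuousOn.rpow_const (ContinuousOn.norm ?_) fun x _ => Or.inr hp.le
      refine hf.comp (by fun_prop) fun ζ hζ => hsub ?_
      have : ‖ζ‖ = 1 := by simpa using hζ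
      simpa [this] using hw
  · have (θ : ℝ) : {w : ℂ | ‖w‖ ∈ S}.indicator (fun w => ‖f w‖ₑ ^ p) (circleMap 0 1 θ * w) = 0 :=
      indicator_of_notMem (by simpa using hw) _
    simp [this]

theorem lintegral_bergmanMeasure (α : ℝ) (g : ℂ → ℝ≥0∞) :
    ∫⁻ z, g z ∂(bergmanMeasure α)
      = ∫⁻ z in disc, ENNReal.ofReal ((1 + α) * (1 - ‖z‖ ^ 2) ^ α / Real.pi) * g z := by
  rw [bergmanMeasure, lintegral_withDensity_eq_lintegral_mul_non_measurable]
  · rfl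
  · fun_prop
  · exact .of_forall fun z => ENNReal.ofReal_lt_top

/-- An annulus of width 2ρ in the disc has area O(ρ), against ρ² for a ball; this lost factor
produces the exponent 1/p for Hardy spaces. -/
theorem volume_annulus_le {R ρ : ℝ} (hR : 0 ≤ R) (hρ : 0 < ρ) (h : R + ρ ≤ 1) :
    volume {w : ℂ | ‖w‖ ∈ Ioo (R - ρ) (R + ρ)} ≤ ENNReal.ofReal (4 * Real.pi * ρ) := by
  have hb (r : ℝ) (hr : 0 ≤ r) : volume (Metric.ball (0 : ℂ) r) = ENNReal.ofReal (Real.pi * r ^ 2) := by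
    rw [Complex.volume_ball, ENNReal.ofReal_mul Real.pi_pos.le, ENNReal.ofReal_pow hr, mul_comm]
    congr 1
    rw [← NNReal.coe_real_pi, ENNReal.ofReal_coe_nnreal]
  have hc (r : ℝ) (hr : 0 ≤ r) :
      volume (Metric.closedBall (0 : ℂ) r) = ENNReal.ofReal (Real.pi * r ^ 2) := by
    rw [Measure.addHaar_closedBall_eq_addHaar_ball, hb r hr]
  have hpi := Real.pi_pos
  rcases lt_or_ge R ρ with hlt | hge
  · calc volume {w : ℂ | ‖w‖ ∈ Ioo (R - ρ) (R + ρ)} ≤ volume (Metric.ball (0 : ℂ) (R + ρ)) :=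
          measure_mono fun w hw => by simpa using hw.2
      _ = ENNReal.ofReal (Real.pi * (R + ρ) ^ 2) := hb _ (by positivity)
      _ ≤ _ := by
          apply ENNReal.ofReal_le_ofReal
          have : (R + ρ) ^ 2 ≤ 4 * ρ := by nlinarith
          nlinarith
  · have hsub : Metric.closedBall (0 : ℂ) (R - ρ) ⊆ Metric.ball 0 (R + ρ) :=
      Metric.closedBall_subset_ball (by linarith)
    have heq : {w : ℂ | ‖w‖ ∈ Ioo (R - ρ) (R + ρ)}
        = Metric.ball 0 (R + ρ) \ Metric.closedBall 0 (R - ρ) := by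
      ext w; simp [and_comm]
    rw [heq, measure_sdiff hsub Metric.isClosed_closedBall.nullMeasurableSet
      (measure_closedBall_lt_top).ne, hb _ (by positivity), hc _ (by linarith),
      ← ENNReal.ofReal_sub _ (by positivity)]
    apply ENNReal.ofReal_le_ofReal
    nlinarith [mul_pos hpi hρ]

theorem min_le_rpow {t b α : ℝ} (ht : 1 ≤ t) (htb : t ≤ b) : min 1 (b ^ α) ≤ t ^ α := by
  rcases le_or_gt 0 α with h | h
  · exact (min_le_left _ _).trans (Real.one_le_rpow ht h)
  · exact (min_le_right _ _).trans (Real.rpow_le_rpow_of_nonpos (by linarith) htb h.le)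

/-- On a ball of radius half the distance to the boundary the weight is comparable to ρ^α. For α =
-1 there is no weight: the ball is enlarged to an annulus of area O(ρ) = O(ρ^(-α)), on which the
circle means apply. -/
theorem setLIntegral_ball_le_bergmanNorm {p α : ℝ} (hp : 0 < p) (hα : -1 ≤ α) :
    ∃ K : ℝ, 0 < K ∧ ∀ f : ℂ → ℂ, DifferentiableOn ℂ f disc → ∀ z ∈ disc, ∀ ρ : ℝ,
      ρ = (1 - ‖z‖) / 2 → ∫⁻ w in Metric.ball z ρ, ‖f w‖ₑ ^ p
        ≤ ENNReal.ofReal (K * ρ ^ (-α)) * bergmanNorm p α f ^ p := by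
  have hball (z : ℂ) (ρ : ℝ) (w : ℂ) (hw : w ∈ Metric.ball z ρ) : ‖w‖ ∈ Ioo (‖z‖ - ρ) (‖z‖ + ρ) := by
    rw [Metric.mem_ball, dist_eq_norm] at hw
    have h1 := norm_sub_norm_le w z
    have h2 := norm_sub_norm_le z w
    rw [norm_sub_rev] at h2
    constructor <;> linarith
  have hpi := Real.pi_pos
  by_cases h1 : α = -1
  · refine ⟨4 * Real.pi, by positivity, fun f hf z hz ρ hρ => ?_⟩
    have hz1 : ‖z‖ < 1 := by simpa using hz
    have hρ0 : 0 < ρ := by linarith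
    rw [bergmanNorm, if_pos h1, h1, neg_neg, Real.rpow_one]
    calc ∫⁻ w in Metric.ball z ρ, ‖f w‖ₑ ^ p
        ≤ ∫⁻ w in {w : ℂ | ‖w‖ ∈ Ioo (‖z‖ - ρ) (‖z‖ + ρ)}, ‖f w‖ₑ ^ p :=
          lintegral_mono_set fun w hw => hball z ρ w hw
      _ ≤ hardyNorm p f ^ p * volume {w : ℂ | ‖w‖ ∈ Ioo (‖z‖ - ρ) (‖z‖ + ρ)} :=
          setLIntegral_le_hardyNorm hp hf.continuousOn measurableSet_Ioo
            fun x hx => by have := hx.2; simp only [mem_Iio]; linarith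
      _ ≤ _ := by
          rw [mul_comm]
          gcongr
          exact volume_annulus_le (norm_nonneg z) hρ0 (by linarith)
  · have hα' : 0 < 1 + α := by
      have := lt_of_le_of_ne hα (Ne.symm h1); linarith
    set c : ℝ := min 1 (6 ^ α) with hc
    have hc0 : 0 < c := by positivity
    refine ⟨Real.pi / ((1 + α) * c), by positivity, fun f hf z hz ρ hρ => ?_⟩
    have hz1 : ‖z‖ < 1 := by simpa using hz
    have hρ0 : 0 < ρ := by linarith
    have hsub : Metric.ball z ρ ⊆ disc := fun w hw => by
      have := (hball z ρ w hw).2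
      simp only [Metric.mem_ball, dist_zero_right]; linarith
    rw [bergmanNorm, if_neg h1, eLpNorm_rpow_eq_lintegral hp, lintegral_bergmanMeasure,
      ← lintegral_const_mul' _ _ ENNReal.ofReal_ne_top]
    refine le_trans ?_ (lintegral_mono_set hsub)
    refine setLIntegral_mono' Metric.isOpen_ball.measurableSet fun w hw => ?_
    rw [← mul_assoc, ← ENNReal.ofReal_mul (by positivity)]
    refine le_mul_of_one_le_left (zero_le) ?_
    rw [ENNReal.one_le_ofReal]
    have hw' := hball z ρ w hw
    have hw0 := norm_nonneg w
    -- Since 1 - ‖z‖ = 2ρ, on the ball ρ < 1 - ‖w‖ < 3ρ, and 1 ≤ 1 + ‖w‖ ≤ 2. The constant c is the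
    -- lower bound of t^α on [1, 6] for either sign of α.
    have ht : 1 ≤ (1 - ‖w‖ ^ 2) / ρ ∧ (1 - ‖w‖ ^ 2) / ρ ≤ 6 := by
      rw [one_le_div hρ0, div_le_iff₀ hρ0]
      have h3 := hw'.1
      have h4 := hw'.2
      constructor <;> nlinarith
    have h5 := min_le_rpow (α := α) ht.1 ht.2
    rw [← hc, Real.div_rpow (by have := ht.1; rw [one_le_div hρ0] at this; linarith) hρ0.le,
      le_div_iff₀ (by positivity)] at h5
    rw [Real.rpow_neg hρ0.le]
    have : Real.pi / ((1 + α) * c) * (ρ ^ α)⁻¹ * ((1 + α) * (1 - ‖w‖ ^ 2) ^ α / Real.pi)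
        = (1 - ‖w‖ ^ 2) ^ α / (c * ρ ^ α) := by field_simp
    rw [this, one_le_div (by positivity)]
    exact h5

/-- Point evaluations on `A^p_α`, with the sharp growth exponent. -/
theorem norm_le_of_bergmanNorm_le {p α : ℝ} (hp : 0 < p) (hα : -1 ≤ α) :
    ∃ C : ℝ, 0 < C ∧ ∀ f : ℂ → ℂ, DifferentiableOn ℂ f disc → ∀ M : ℝ≥0, bergmanNorm p α f ≤ M →
      ∀ z ∈ disc, ‖f z‖ ≤ C * M / (1 - ‖z‖) ^ ((2 + α) / p) := by
  obtain ⟨K, hK, h⟩ := setLIntegral_ball_le_bergmanNorm hp hα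
  have hpi := Real.pi_pos
  refine ⟨(K / Real.pi) ^ p⁻¹ * 2 ^ ((2 + α) / p), by positivity, fun f hf M hM z hz => ?_⟩
  have hz1 : ‖z‖ < 1 := by simpa using hz
  set ρ : ℝ := (1 - ‖z‖) / 2 with hρ
  have hρ0 : 0 < ρ := by linarith
  have hsub : Metric.ball z ρ ⊆ disc := by
    intro w hw
    rw [Metric.mem_ball, dist_eq_norm] at hw
    have h1 := norm_sub_norm_le w z
    simp only [Metric.mem_ball, dist_zero_right]; linarith
  have h1 := (rpow_mul_volume_ball_le hp (hf.mono hsub)).trans (h f hf z hz ρ hρ)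
  have h2 : ‖f z‖ₑ ^ p * volume (Metric.ball z ρ) ≤ ENNReal.ofReal (K * ρ ^ (-α) * (M : ℝ) ^ p) := by
    refine h1.trans ?_
    rw [ENNReal.ofReal_mul (p := K * ρ ^ (-α)) (by positivity),
      ← ENNReal.ofReal_rpow_of_nonneg M.coe_nonneg hp.le,
      ENNReal.ofReal_coe_nnreal]
    gcongr
  have hv : volume (Metric.ball z ρ) = ENNReal.ofReal (Real.pi * ρ ^ 2) := by
    rw [Complex.volume_ball, ENNReal.ofReal_mul Real.pi_pos.le, ENNReal.ofReal_pow hρ0.le, mul_comm]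
    congr 1
    rw [← NNReal.coe_real_pi, ENNReal.ofReal_coe_nnreal]
  rw [hv, enorm_rpow_eq_ofReal hp, ← ENNReal.ofReal_mul (by positivity),
    ENNReal.ofReal_le_ofReal_iff (by positivity)] at h2
  have h3 : ‖f z‖ ^ p ≤ (K / Real.pi) * ρ ^ (-(2 + α)) * (M : ℝ) ^ p := by
    rw [← mul_assoc, ← le_div_iff₀ (by positivity), ← le_div_iff₀ (by positivity)] at h2
    refine h2.trans_eq ?_
    rw [neg_add, Real.rpow_add hρ0, Real.rpow_neg hρ0.le 2]
    norm_num
    field_simp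
  have h4 := Real.rpow_le_rpow (by positivity) h3 (inv_nonneg.2 hp.le)
  rw [Real.rpow_rpow_inv (norm_nonneg _) hp.ne', Real.mul_rpow (by positivity) (by positivity),
    Real.mul_rpow (by positivity) (by positivity), Real.rpow_rpow_inv M.coe_nonneg hp.ne',
    ← Real.rpow_mul hρ0.le, neg_mul, ← div_eq_mul_inv, Real.rpow_neg hρ0.le] at h4
  refine h4.trans_eq ?_
  rw [hρ, Real.div_rpow (sub_nonneg.2 hz1.le) zero_le_two, inv_div]
  ring

/-! ### Disc automorphisms and norm bounds by the kernel -/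

theorem one_sub_mul_ne_zero {a w : ℂ} (ha : ‖a‖ < 1) (hw : ‖w‖ ≤ 1) : 1 - conj a * w ≠ 0 := by
  intro h
  have h1 : ‖conj a * w‖ = 1 := by rw [← sub_eq_zero.1 h, norm_one]
  rw [norm_mul, RCLike.norm_conj] at h1
  nlinarith [norm_nonneg a, norm_nonneg w]

theorem one_sub_norm_le_norm {a w : ℂ} (ha : ‖a‖ ≤ 1) : 1 - ‖w‖ ≤ ‖1 - conj a * w‖ := by
  have h1 : ‖(1 : ℂ)‖ - ‖conj a * w‖ ≤ ‖1 - conj a * w‖ := norm_sub_norm_le _ _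
  rw [norm_one, norm_mul, RCLike.norm_conj] at h1
  nlinarith [norm_nonneg a, norm_nonneg w]

theorem one_sub_norm_le_norm' {a w : ℂ} (hw : ‖w‖ ≤ 1) : 1 - ‖a‖ ≤ ‖1 - conj a * w‖ := by
  have h1 : ‖(1 : ℂ)‖ - ‖conj a * w‖ ≤ ‖1 - conj a * w‖ := norm_sub_norm_le _ _
  rw [norm_one, norm_mul, RCLike.norm_conj] at h1
  nlinarith [norm_nonneg a, norm_nonneg w]

/-- The involutive automorphism of the disc that exchanges `0` and `a`. -/
noncomputable def discInvolution (a w : ℂ) : ℂ := (a - w) / (1 - conj a * w)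

theorem one_sub_norm_discInvolution {a w : ℂ} (ha : ‖a‖ < 1) (hw : ‖w‖ < 1) :
    1 - ‖discInvolution a w‖ ^ 2 = (1 - ‖a‖ ^ 2) * (1 - ‖w‖ ^ 2) / ‖1 - conj a * w‖ ^ 2 := by
  have h0 : ‖1 - conj a * w‖ ^ 2 ≠ 0 :=
    pow_ne_zero 2 (norm_ne_zero_iff.2 (one_sub_mul_ne_zero ha hw.le))
  rw [discInvolution, norm_div, div_pow, eq_div_iff h0, sub_mul, div_mul_cancel₀ _ h0]
  simp only [Complex.sq_norm, Complex.normSq_apply]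
  simp
  ring

theorem discInvolution_mem {a w : ℂ} (ha : ‖a‖ < 1) (hw : ‖w‖ < 1) : discInvolution a w ∈ disc := by
  have h := one_sub_norm_discInvolution ha hw
  have h1 : 0 < (1 - ‖a‖ ^ 2) * (1 - ‖w‖ ^ 2) / ‖1 - conj a * w‖ ^ 2 := by
    have := norm_pos_iff.2 (one_sub_mul_ne_zero ha hw.le)
    have h2 : 0 < 1 - ‖a‖ ^ 2 := by nlinarith [norm_nonneg a]
    have h3 : 0 < 1 - ‖w‖ ^ 2 := by nlinarith [norm_nonneg w]
    positivity
  rw [← h] at h1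
  simp only [Metric.mem_ball, dist_zero_right]
  nlinarith [norm_nonneg (discInvolution a w)]

theorem injOn_discInvolution {a : ℂ} (ha : ‖a‖ < 1) : InjOn (discInvolution a) disc := by
  intro w hw v hv h
  have hw1 : ‖w‖ < 1 := by simpa using hw
  have hv1 : ‖v‖ < 1 := by simpa using hv
  rw [discInvolution, discInvolution, div_eq_div_iff (one_sub_mul_ne_zero ha hw1.le)
    (one_sub_mul_ne_zero ha hv1.le)] at h
  have h1 : (1 - conj a * a) * (w - v) = 0 := by linear_combination -h
  rcases mul_eq_zero.1 h1 with h2 | h2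
  · exact absurd h2 (one_sub_mul_ne_zero ha ha.le)
  · exact sub_eq_zero.1 h2

theorem hasDerivAt_discInvolution {a w : ℂ} (ha : ‖a‖ < 1) (hw : ‖w‖ < 1) :
    HasDerivAt (discInvolution a) (-(1 - conj a * a) / (1 - conj a * w) ^ 2) w := by
  have h1 : HasDerivAt (fun w : ℂ => a - w) (-1) w := (hasDerivAt_id w).const_sub a
  have h2 : HasDerivAt (fun w : ℂ => 1 - conj a * w) (-(conj a * 1)) w :=
    ((hasDerivAt_id w).const_mul (conj a)).const_sub 1
  exact (h1.div h2 (one_sub_mul_ne_zero ha hw.le)).congr_deriv (by congr 1; ring)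

/-- A change of variables for an injective holomorphic map. -/
theorem lintegral_image_eq_lintegral_norm_deriv_sq {s : Set ℂ} (hs : MeasurableSet s) {f f' : ℂ → ℂ}
    (hf : ∀ z ∈ s, HasDerivAt f (f' z) z) (hinj : InjOn f s) (g : ℂ → ℝ≥0∞) :
    ∫⁻ z in f '' s, g z = ∫⁻ z in s, ENNReal.ofReal (‖f' z‖ ^ 2) * g (f z) := by
  rw [lintegral_image_eq_lintegral_abs_det_fderiv_mul volume hs
    (f' := fun z => (ContinuousLinearMap.toSpanSingleton ℂ (f' z)).restrictScalars ℝ)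
    (fun z hz => ((hf z hz).hasFDerivAt.restrictScalars ℝ).hasFDerivWithinAt) hinj]
  refine setLIntegral_congr_fun hs fun z _ => ?_
  simp [ContinuousLinearMap.det, LinearMap.det_restrictScalars,
      Algebra.norm_complex_eq, Complex.normSq_eq_norm_sq]

/-- The Möbius invariance of the measures `dA_α`, as an inequality. -/
theorem lintegral_kernel_le {α : ℝ} (hα : -1 < α) {a : ℂ} (ha : ‖a‖ < 1) :
    ∫⁻ w, ENNReal.ofReal (((1 - ‖a‖ ^ 2) / ‖1 - conj a * w‖ ^ 2) ^ (2 + α)) ∂(bergmanMeasure α)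
      ≤ bergmanMeasure α univ := by
  have hA : 0 < 1 - ‖a‖ ^ 2 := by nlinarith [norm_nonneg a]
  rw [← lintegral_one, lintegral_bergmanMeasure, lintegral_bergmanMeasure]
  have himg : discInvolution a '' disc ⊆ disc := by
    rintro _ ⟨w, hw, rfl⟩
    exact discInvolution_mem ha (by simpa using hw)
  -- After the substitution by the involution, the Jacobian contributes the kernel squared and the
  -- weight contributes its power α. The image is in fact all of the disc, but the inclusion
  -- suffices.
  refine le_trans ?_ (lintegral_mono_set himg)
  rw [lintegral_image_eq_lintegral_norm_deriv_sq Metric.isOpen_ball.measurableSet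
    (fun w hw => hasDerivAt_discInvolution ha (by simpa using hw)) (injOn_discInvolution ha)]
  refine setLIntegral_mono' Metric.isOpen_ball.measurableSet fun w hw => le_of_eq ?_
  have hw1 : ‖w‖ < 1 := by simpa using hw
  have hW : 0 < 1 - ‖w‖ ^ 2 := by nlinarith [norm_nonneg w]
  have hn := norm_pos_iff.2 (one_sub_mul_ne_zero ha hw1.le)
  have hpi := Real.pi_pos
  have hα' : 0 < 1 + α := by linarith
  rw [mul_one, ← ENNReal.ofReal_mul (by positivity), ← ENNReal.ofReal_mul (by positivity)]
  congr 1
  rw [one_sub_norm_discInvolution ha hw1]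
  have h1 : ‖-(1 - conj a * a) / (1 - conj a * w) ^ 2‖ = (1 - ‖a‖ ^ 2) / ‖1 - conj a * w‖ ^ 2 := by
    rw [norm_div, norm_neg, norm_pow]
    congr 1
    rw [← Complex.normSq_eq_conj_mul_self, Complex.normSq_eq_norm_sq]
    rw [← Complex.ofReal_one, ← Complex.ofReal_sub, Complex.norm_of_nonneg hA.le]
  have h2 : (1 - ‖a‖ ^ 2) * (1 - ‖w‖ ^ 2) / ‖1 - conj a * w‖ ^ 2
      = (1 - ‖a‖ ^ 2) / ‖1 - conj a * w‖ ^ 2 * (1 - ‖w‖ ^ 2) := by ring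
  rw [h1, h2, Real.rpow_add (by positivity), Real.mul_rpow (by positivity) hW.le, Real.rpow_two]
  ring

/-- In polar coordinates (1 - y²)^α = (1 + y)^α (1 - y)^α; the first factor is bounded on (0, 1) and
the second is integrable because α > -1. -/
theorem bergmanMeasure_univ_lt_top {α : ℝ} (hα : -1 < α) : bergmanMeasure α univ < ∞ := by
  rw [← lintegral_one, lintegral_bergmanMeasure]
  simp only [mul_one]
  have hint : IntegrableOn (fun z : ℂ => (1 + α) * (1 - ‖z‖ ^ 2) ^ α / Real.pi) disc := by
    refine Integrable.div_const (Integrable.const_mul ?_ _) _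
    refine (integrableOn_fun_norm_addHaar volume (f := fun y : ℝ => (1 - y ^ 2) ^ α)).2 ?_
    have h1 : IntegrableOn (fun y : ℝ => (1 - y) ^ α) (Ioo 0 1) := by
      have h := (intervalIntegral.intervalIntegrable_rpow' (a := 0) (b := 1) hα).comp_sub_left 1
      rw [sub_zero, sub_self] at h
      exact ((intervalIntegrable_iff_integrableOn_Ioc_of_le zero_le_one).1 h.symm).mono_set
        Ioo_subset_Ioc_self
    refine Integrable.mono' (h1.const_mul (max 1 (2 ^ α))) (by fun_prop) ?_
    filter_upwards [ae_restrict_mem measurableSet_Ioo] with y hy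
    obtain ⟨hy0, hy1⟩ := hy
    have h2 : (1 : ℝ) - y ^ 2 = (1 + y) * (1 - y) := by ring
    have h3 : 0 < 1 - y := by linarith
    have h4 : (1 + y) ^ α ≤ max 1 (2 ^ α) := by
      rcases le_or_gt 0 α with h | h
      · exact (Real.rpow_le_rpow (by linarith) (by linarith) h).trans (le_max_right _ _)
      · exact (Real.rpow_le_one_of_one_le_of_nonpos (by linarith) h.le).trans (le_max_left _ _)
    rw [Complex.finrank_real_complex, h2, Real.mul_rpow (by linarith) h3.le, smul_eq_mul,
      Real.norm_of_nonneg (by positivity)]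
    have h5 : 0 ≤ (1 + y) ^ α * (1 - y) ^ α := by positivity
    calc y ^ (2 - 1) * ((1 + y) ^ α * (1 - y) ^ α) ≤ 1 * ((1 + y) ^ α * (1 - y) ^ α) := by
          gcongr; simpa using hy1.le
      _ ≤ _ := by rw [one_mul]; gcongr
  exact hint.lintegral_lt_top

/-- On |w| = r the kernel is a multiple of the Poisson kernel of the point a r², the reflection of
the pole 1/ā. The mean is therefore (1 - |a|²)/(1 - |a|² r²). This is the case α = -1 of the uniform
kernel bound. -/
theorem circleAverage_kernel_le {a : ℂ} (ha : ‖a‖ < 1) {r : ℝ} (hr : 0 ≤ r) (hr1 : r < 1) :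
    Real.circleAverage (fun w => (1 - ‖a‖ ^ 2) / ‖1 - conj a * w‖ ^ 2) 0 r ≤ 1 := by
  have hA : 0 < 1 - ‖a‖ ^ 2 := by nlinarith [norm_nonneg a]
  rcases hr.eq_or_lt with rfl | hr0
  · simp
  have hb : a * (r : ℂ) ^ 2 ∈ Metric.ball (0 : ℂ) r := by
    simp only [Metric.mem_ball, dist_zero_right, norm_mul, norm_pow, Complex.norm_real,
      Real.norm_eq_abs, abs_of_pos hr0]
    nlinarith [norm_nonneg a, mul_pos hr0 hr0]
  have hB : 0 < 1 - ‖a‖ ^ 2 * r ^ 2 := by nlinarith [norm_nonneg a, sq_nonneg ‖a‖]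
  have key : EqOn (fun w => (1 - ‖a‖ ^ 2) / ‖1 - conj a * w‖ ^ 2)
      (fun w => ((1 - ‖a‖ ^ 2) / (1 - ‖a‖ ^ 2 * r ^ 2)) •
        (poissonKernel 0 (a * (r : ℂ) ^ 2) • (fun _ => (1 : ℝ))) w) (Metric.sphere 0 |r|) := by
    intro w hw
    have hw' : ‖w‖ = r := by simpa [abs_of_pos hr0] using hw
    have h1 : w * conj w = (r : ℂ) ^ 2 := by
      rw [Complex.mul_conj, Complex.normSq_eq_norm_sq, hw']; push_cast; ring
    have h2 : ‖w - a * (r : ℂ) ^ 2‖ = r * ‖1 - conj a * w‖ := by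
      have : w - a * (r : ℂ) ^ 2 = w * conj (1 - conj a * w) := by
        rw [← h1]; simp; ring
      rw [this, norm_mul, hw', RCLike.norm_conj]
    have h3 : ‖1 - conj a * w‖ ≠ 0 :=
      norm_ne_zero_iff.2 (one_sub_mul_ne_zero ha (by rw [hw']; exact hr1.le))
    simp only [smul_eq_mul, Pi.smul_apply', mul_one, poissonKernel_def, sub_zero, h2, hw', norm_mul,
      norm_pow, Complex.norm_real, Real.norm_eq_abs, abs_of_pos hr0]
    field_simp
  rw [Real.circleAverage_congr_sphere key, Real.circleAverage_fun_smul,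
    InnerProductSpace.HarmonicOnNhd.circleAverage_poissonKernel_smul (by simp) hb, smul_eq_mul,
    mul_one, div_le_one hB]
  have := mul_le_mul_of_nonneg_left (pow_le_one₀ hr hr1.le (n := 2)) (sq_nonneg ‖a‖)
  linarith

/-- Functions dominated by a power of the kernel `(1 - |a|²) / |1 - \bar a w|²` have bounded norm,
uniformly in `a`. -/
theorem bergmanNorm_le_of_kernel {p α : ℝ} (hp : 0 < p) (hα : -1 ≤ α) :
    ∃ C : ℝ≥0, ∀ a : ℂ, ‖a‖ < 1 → ∀ (K : ℝ≥0) (f : ℂ → ℂ),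
      (∀ w ∈ disc, ‖f w‖ ≤ K * ((1 - ‖a‖ ^ 2) / ‖1 - conj a * w‖ ^ 2) ^ ((2 + α) / p)) →
      bergmanNorm p α f ≤ (K * C : ℝ≥0) := by
  have key (a : ℂ) (ha : ‖a‖ < 1) (K : ℝ≥0) (f : ℂ → ℂ)
      (h : ∀ w ∈ disc, ‖f w‖ ≤ K * ((1 - ‖a‖ ^ 2) / ‖1 - conj a * w‖ ^ 2) ^ ((2 + α) / p))
      (w : ℂ) (hw : w ∈ disc) : ‖f w‖ₑ ^ p ≤
        (K : ℝ≥0∞) ^ p * ENNReal.ofReal (((1 - ‖a‖ ^ 2) / ‖1 - conj a * w‖ ^ 2) ^ (2 + α)) := by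
    have hA : 0 < 1 - ‖a‖ ^ 2 := by nlinarith [norm_nonneg a]
    rw [enorm_rpow_eq_ofReal hp, ← ENNReal.ofReal_coe_nnreal,
      ENNReal.ofReal_rpow_of_nonneg K.coe_nonneg hp.le, ← ENNReal.ofReal_mul (by positivity)]
    apply ENNReal.ofReal_le_ofReal
    refine (Real.rpow_le_rpow (norm_nonneg _) (h w hw) hp.le).trans_eq ?_
    rw [Real.mul_rpow K.coe_nonneg (by positivity), ← Real.rpow_mul (by positivity),
      div_mul_cancel₀ _ hp.ne']
  by_cases h1 : α = -1
  · refine ⟨1, fun a ha K f h => ?_⟩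
    have hA : 0 < 1 - ‖a‖ ^ 2 := by nlinarith [norm_nonneg a]
    rw [bergmanNorm, if_pos h1, mul_one]
    refine iSup₂_le fun r hr => (eLpNorm_le_iff_lintegral hp).2 ?_
    have hin (θ : ℝ) : circleMap 0 r θ ∈ disc := by simp [abs_of_nonneg hr.1, hr.2]
    refine (lintegral_mono fun θ => key a ha K f h _ (hin θ)).trans ?_
    rw [lintegral_const_mul' _ _ (ENNReal.rpow_ne_top_of_nonneg hp.le ENNReal.coe_ne_top)]
    refine mul_le_of_le_one_right (zero_le) ?_
    subst h1
    norm_num only [Real.rpow_one]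
    rw [lintegral_angleMeasure_eq (g := fun w => (1 - ‖a‖ ^ 2) / ‖1 - conj a * w‖ ^ 2)
      (fun z => by positivity)]
    · exact ENNReal.ofReal_le_one.2 (circleAverage_kernel_le ha hr.1 hr.2)
    · refine ContinuousOn.div (by fun_prop) (by fun_prop) fun w hw => ?_
      have hw' : ‖w‖ = r := by simpa [abs_of_nonneg hr.1] using hw
      exact pow_ne_zero 2 (norm_ne_zero_iff.2 (one_sub_mul_ne_zero ha (hw' ▸ hr.2.le)))
  · have hα' : -1 < α := lt_of_le_of_ne hα (Ne.symm h1)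
    have hfin := bergmanMeasure_univ_lt_top hα'
    refine ⟨(bergmanMeasure α univ).toNNReal ^ p⁻¹, fun a ha K f h => ?_⟩
    rw [bergmanNorm, if_neg h1, eLpNorm_le_iff_lintegral hp, ENNReal.coe_mul,
      ENNReal.mul_rpow_of_nonneg _ _ hp.le, ENNReal.coe_rpow_of_nonneg _ (inv_nonneg.2 hp.le),
      ENNReal.rpow_inv_rpow hp.ne', ENNReal.coe_toNNReal hfin.ne]
    have hae : ∀ᵐ w ∂(bergmanMeasure α), w ∈ disc :=
      (withDensity_absolutelyContinuous _ _).ae_le (ae_restrict_mem Metric.isOpen_ball.measurableSet)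
    refine (lintegral_mono_ae (hae.mono fun w hw => key a ha K f h w hw)).trans ?_
    rw [lintegral_const_mul' _ _ (ENNReal.rpow_ne_top_of_nonneg hp.le ENNReal.coe_ne_top)]
    gcongr
    exact lintegral_kernel_le hα' ha

/-! ### Growth of derivatives -/

theorem differentiableOn_iteratedDeriv {f : ℂ → ℂ} (hf : DifferentiableOn ℂ f disc) (k : ℕ) :
    DifferentiableOn ℂ (iteratedDeriv k f) disc := by
  rw [iteratedDeriv_eq_iterate]
  exact ((hf.analyticOnNhd Metric.isOpen_ball).iterated_deriv k).differentiableOn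

theorem closedBall_half_subset {z w : ℂ} (hw : ‖w - z‖ ≤ (1 - ‖z‖) / 2) :
    (1 - ‖z‖) / 2 ≤ 1 - ‖w‖ := by
  have h1 := norm_sub_norm_le w z
  linarith

/-- Growth of the derivatives of functions in `A^p_α`. -/
theorem norm_iteratedDeriv_le_of_bergmanNorm_le {p α : ℝ} (hp : 0 < p) (hα : -1 ≤ α) (k : ℕ) :
    ∃ C : ℝ, 0 < C ∧ ∀ f : ℂ → ℂ, DifferentiableOn ℂ f disc → ∀ M : ℝ≥0, bergmanNorm p α f ≤ M →
      ∀ z ∈ disc, ‖iteratedDeriv k f z‖ ≤ C * M / (1 - ‖z‖) ^ ((2 + α) / p + k) := by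
  obtain ⟨C, hC, h⟩ := norm_le_of_bergmanNorm_le hp hα
  have hγ : 0 ≤ (2 + α) / p := div_nonneg (by linarith) hp.le
  refine ⟨k.factorial * C * 2 ^ ((2 + α) / p + k), by positivity, fun f hf M hM z hz => ?_⟩
  have hz1 : ‖z‖ < 1 := by simpa using hz
  -- Points of the circle of radius R about z stay at distance at least R from the boundary, so
  -- Cauchy's estimate costs exactly one factor 1/R per derivative.
  set R : ℝ := (1 - ‖z‖) / 2 with hR
  have hR0 : 0 < R := by linarith
  have hsub : Metric.closedBall z R ⊆ disc := by
    intro w hw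
    have := closedBall_half_subset (mem_closedBall_iff_norm.1 hw)
    simp only [Metric.mem_ball, dist_zero_right]; linarith
  have h1 := Complex.norm_iteratedDeriv_le_of_forall_mem_sphere_norm_le (f := f) (c := z)
    (C := C * M / R ^ ((2 + α) / p)) k hR0
    ((hf.mono (by rw [closure_ball z hR0.ne']; exact hsub)).diffContOnCl) fun w hw => by
      have hw' := Metric.sphere_subset_closedBall hw
      refine (h f hf M hM w (hsub hw')).trans ?_
      gcongr
      exact closedBall_half_subset (mem_closedBall_iff_norm.1 hw')
  refine h1.trans_eq ?_
  have h2 : R ^ ((2 + α) / p + k) = (1 - ‖z‖) ^ ((2 + α) / p + k) / 2 ^ ((2 + α) / p + k) := by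
    rw [hR, Real.div_rpow (sub_nonneg.2 hz1.le) zero_le_two]
  have h3 : R ^ ((2 + α) / p + k) = R ^ ((2 + α) / p) * R ^ k := by
    rw [Real.rpow_add hR0, Real.rpow_natCast]
  rw [mul_div_assoc', div_div, ← h3, h2, div_div_eq_mul_div]
  ring

/-! ### The Banach space H^∞ -/

theorem memHInfty_iff {g : ℂ → ℂ} :
    MemHInfty g ↔ DifferentiableOn ℂ g disc ∧ ∃ B : ℝ, 0 ≤ B ∧ ∀ z ∈ disc, ‖g z‖ ≤ B := by
  refine and_congr_right fun _ => ⟨fun h => ?_, ?_⟩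
  · refine ⟨(supNorm g).toReal, ENNReal.toReal_nonneg, fun z hz => ?_⟩
    have h1 : ‖g z‖ₑ ≤ supNorm g := le_iSup₂_of_le z hz le_rfl
    simpa using ENNReal.toReal_mono h.ne h1
  · rintro ⟨B, hB, h⟩
    refine (iSup₂_le fun z hz => ?_).trans_lt (ENNReal.ofReal_lt_top (r := B))
    rw [← ofReal_norm]
    exact ENNReal.ofReal_le_ofReal (h z hz)

/-- A bounded holomorphic function as an element of the normed space `H^∞`. -/
theorem MemHInfty.exists_eq {g : ℂ → ℂ} (hg : MemHInfty g) :
    ∃ G : HInfty, ∀ z : disc, (G : disc →ᵇ ℂ) z = g z := by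
  obtain ⟨hd, B, hB, h⟩ := memHInfty_iff.1 hg
  exact ⟨⟨BoundedContinuousFunction.ofNormedAddCommGroup (fun z : disc => g z)
    hd.continuousOn.domRestrict B fun z => h z z.2, g, hd, fun z => rfl⟩, fun z => rfl⟩

theorem supNorm_eq_enorm {g : ℂ → ℂ} (G : HInfty) (h : ∀ z : disc, (G : disc →ᵇ ℂ) z = g z) :
    supNorm g = ‖G‖ₑ := by
  apply le_antisymm
  · refine iSup₂_le fun z hz => ?_
    rw [← h ⟨z, hz⟩, ← ofReal_norm, ← ofReal_norm]
    exact ENNReal.ofReal_le_ofReal ((G : disc →ᵇ ℂ).norm_coe_le_norm ⟨z, hz⟩)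
  · by_cases htop : supNorm g = ∞
    · simp [htop]
    rw [← ofReal_norm]
    refine ENNReal.ofReal_le_of_le_toReal ?_
    refine (BoundedContinuousFunction.norm_le ENNReal.toReal_nonneg).2 fun z => ?_
    have h1 : ‖g z‖ₑ ≤ supNorm g := le_iSup₂_of_le (z : ℂ) z.2 le_rfl
    change ‖(G : disc →ᵇ ℂ) z‖ ≤ _
    rw [h z]
    simpa using ENNReal.toReal_mono htop h1

/-- Uniform limits of holomorphic functions are holomorphic. Completeness reduces relative
compactness to total boundedness. -/
instance : CompleteSpace HInfty := by
  refine IsClosed.completeSpace_coe (hs := isClosed_of_closure_subset fun g hg => ?_)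
  obtain ⟨G, hG, hlim⟩ := mem_closure_iff_seq_limit.1 hg
  choose F hF hFG using hG
  classical
  refine ⟨fun z => if hz : z ∈ disc then g ⟨z, hz⟩ else 0, ?_, fun z => by simp [z.2]⟩
  have hu : TendstoUniformlyOn F (fun z => if hz : z ∈ disc then g ⟨z, hz⟩ else 0) atTop disc := by
    rw [Metric.tendstoUniformlyOn_iff]
    intro ε hε
    filter_upwards [Metric.tendsto_atTop'.1 hlim ε hε |>.choose_spec |> fun h =>
      eventually_gt_atTop _ |>.mono h] with n hn z hz
    rw [dif_pos hz, ← hFG n ⟨z, hz⟩, dist_comm]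
    exact (BoundedContinuousFunction.dist_coe_le_dist _).trans_lt hn
  exact hu.tendstoLocallyUniformlyOn.differentiableOn (.of_forall hF) Metric.isOpen_ball

/-! ### Decay of the symbols implies compactness -/

theorem exists_lt_of_eventually_towardBoundary {φ : ℂ → ℂ} {P : ℂ → Prop}
    (h : ∀ᶠ z in towardBoundary φ, P z) (hφ : MapsTo φ disc disc) :
    ∃ δ : ℝ, 0 < δ ∧ δ < 1 ∧ ∀ z ∈ disc, δ < ‖φ z‖ → P z := by
  rw [towardBoundary, eventually_inf_principal, eventually_comap] at h
  obtain ⟨η, hη, h⟩ := Metric.eventually_nhds_iff.1 h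
  refine ⟨max (1 - η) 2⁻¹, by positivity, by rw [max_lt_iff]; constructor <;> norm_num [hη],
    fun z hz hδ => h ?_ z rfl hz⟩
  have h1 : ‖φ z‖ < 1 := by simpa using hφ hz
  have h2 := (le_max_left _ _).trans_lt hδ
  rw [Real.dist_eq, abs_lt]
  constructor <;> linarith

theorem exists_growth_bound {p α : ℝ} {k : ℕ} {u φ : ℂ → ℂ} (hφ : MapsTo φ disc disc)
    (hlim : Tendsto (fun z => ‖u z‖ / (1 - ‖φ z‖ ^ 2) ^ ((2 + α) / p + (k : ℝ)))
      (towardBoundary φ) (𝓝 0)) {ε : ℝ} (hε : 0 < ε) :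
    ∃ δ : ℝ, 0 < δ ∧ δ < 1 ∧ ∀ z ∈ disc, δ < ‖φ z‖ →
      ‖u z‖ ≤ ε * (1 - ‖φ z‖ ^ 2) ^ ((2 + α) / p + (k : ℝ)) := by
  refine exists_lt_of_eventually_towardBoundary ?_ hφ
  have h2 : ∀ᶠ z in towardBoundary φ, z ∈ disc := by
    rw [towardBoundary]; exact mem_inf_of_right (mem_principal_self _)
  filter_upwards [hlim.eventually (gt_mem_nhds hε), h2] with z hz hzd
  have h3 : ‖φ z‖ < 1 := by simpa using hφ hzd
  have h4 : 0 < 1 - ‖φ z‖ ^ 2 := by nlinarith [norm_nonneg (φ z)]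
  rw [div_lt_iff₀ (by positivity)] at hz
  exact hz.le

theorem one_sub_sq_rpow_le {t s : ℝ} (h0 : 0 ≤ t) (h1 : t < 1) (hs : 0 ≤ s) :
    (1 - t ^ 2) ^ s ≤ 2 ^ s * (1 - t) ^ s := by
  rw [← Real.mul_rpow zero_le_two (by linarith)]
  exact Real.rpow_le_rpow (by nlinarith) (by nlinarith) hs

/-- The images of a ball are uniformly small where |φ| > δ. Where |φ| ≤ δ an Arzelà–Ascoli argument,
done by hand, assigns to each image one of finitely many codes such that equal codes force distance
at most ε/2. -/
theorem isCompact_weightedDiffComp {p α : ℝ} (hp : 0 < p) (hα : -1 ≤ α) {k : ℕ} {u φ : ℂ → ℂ}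
    (hφd : DifferentiableOn ℂ φ disc) (hφ : MapsTo φ disc disc) (hu : MemHInfty u)
    (hlim : Tendsto (fun z => ‖u z‖ / (1 - ‖φ z‖ ^ 2) ^ ((2 + α) / p + (k : ℝ)))
      (towardBoundary φ) (𝓝 0)) :
    IsCompactBergmanToHInfty p α (weightedDiffComp k u φ) := by
  obtain ⟨hud, B, hB, huB⟩ := memHInfty_iff.1 hu
  obtain ⟨C, hC, hCf⟩ := norm_iteratedDeriv_le_of_bergmanNorm_le hp hα k
  obtain ⟨C', hC', hCf'⟩ := norm_iteratedDeriv_le_of_bergmanNorm_le hp hα (k + 1)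
  set s : ℝ := (2 + α) / p + k with hs
  have hs0 : 0 ≤ s := add_nonneg (div_nonneg (by linarith) hp.le) (Nat.cast_nonneg k)
  have hφ1 : ∀ z ∈ disc, ‖φ z‖ < 1 := fun z hz => by simpa using hφ hz
  have hnear {ε δ : ℝ} (hε : 0 < ε) (h : ∀ z ∈ disc, δ < ‖φ z‖ → ‖u z‖ ≤ ε * (1 - ‖φ z‖ ^ 2) ^ s)
      {f : ℂ → ℂ} (hf : DifferentiableOn ℂ f disc) {M : ℝ≥0} (hM : bergmanNorm p α f ≤ M)
      {z : ℂ} (hz : z ∈ disc) (hδ : δ < ‖φ z‖) :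
      ‖weightedDiffComp k u φ f z‖ ≤ ε * (2 ^ s * C * M) := by
    have h1 : 0 < 1 - ‖φ z‖ := by linarith [hφ1 z hz]
    rw [weightedDiffComp, norm_mul]
    calc ‖u z‖ * ‖iteratedDeriv k f (φ z)‖
        ≤ (ε * (2 ^ s * (1 - ‖φ z‖) ^ s)) * (C * M / (1 - ‖φ z‖) ^ s) := by
          refine mul_le_mul ((h z hz hδ).trans ?_) (hCf f hf M hM _ (hφ hz)) (norm_nonneg _)
            (by positivity)
          gcongr
          exact one_sub_sq_rpow_le (norm_nonneg _) (hφ1 z hz) hs0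
      _ = _ := by
          field_simp
  refine ⟨fun f hf => memHInfty_iff.2 ⟨?_, ?_⟩, fun M => ?_⟩
  · exact hud.mul ((differentiableOn_iteratedDeriv hf.1 k).comp hφd hφ)
  · obtain ⟨δ, hδ0, hδ1, hδ⟩ := exists_growth_bound hφ hlim one_pos
    obtain ⟨M, hM⟩ : ∃ M : ℝ≥0, bergmanNorm p α f = M := ⟨_, (ENNReal.coe_toNNReal hf.2.ne).symm⟩
    have hδ' : 0 < 1 - δ := by linarith
    refine ⟨max (1 * (2 ^ s * C * M)) (B * (C * M / (1 - δ) ^ s)), by positivity, fun z hz => ?_⟩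
    rcases lt_or_ge δ ‖φ z‖ with h | h
    · exact (hnear one_pos hδ hf.1 hM.le hz h).trans (le_max_left _ _)
    · refine le_trans ?_ (le_max_right _ _)
      rw [weightedDiffComp, norm_mul]
      refine mul_le_mul (huB z hz) ((hCf f hf.1 M hM.le _ (hφ hz)).trans ?_) (norm_nonneg _) hB
      gcongr
  · refine TotallyBounded.isCompact_of_isClosed (TotallyBounded.closure ?_) isClosed_closure
    refine Metric.totallyBounded_of_finite_discretization fun ε hε => ?_
    set ε' : ℝ := ε / (4 * (2 ^ s * C * M + 1)) with hε'
    have hε'0 : 0 < ε' := by positivity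
    obtain ⟨δ, hδ0, hδ1, hδ⟩ := exists_growth_bound hφ hlim hε'0
    have hδ' : 0 < 1 - δ := by linarith
    -- The bound on the derivative of order k + 1 makes L a common Lipschitz constant of all f^(k)
    -- on |w| ≤ δ.
    set L : ℝ := C' * M / (1 - δ) ^ ((2 + α) / p + (k + 1 : ℕ)) with hL
    have hL0 : 0 ≤ L := by positivity
    set η : ℝ := ε / (2 * (B * (2 * L + 2) + 1)) with hη
    have hη0 : 0 < η := by positivity
    -- The set t is an η-net of the disc |w| ≤ δ. Below, t₂ is an η-net of the possible value
    -- vectors of f^(k) on t, and the code of g is a point of t₂ within η of its vector.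
    obtain ⟨t, htK, htf, ht⟩ := (isCompact_closedBall (0 : ℂ) δ).finite_cover_balls hη0
    have := htf.fintype
    have hK {w : ℂ} (hw : w ∈ Metric.closedBall (0 : ℂ) δ) : w ∈ disc ∧ 1 - δ ≤ 1 - ‖w‖ := by
      have : ‖w‖ ≤ δ := by simpa using hw
      exact ⟨by simpa using this.trans_lt hδ1, by linarith⟩
    set R : ℝ := C * M / (1 - δ) ^ s with hR
    have hR0 : 0 ≤ R := by positivity
    obtain ⟨t₂, -, ht₂f, ht₂⟩ := (isCompact_closedBall (0 : t → ℂ) R).finite_cover_balls hη0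
    have := ht₂f.fintype
    set S := {g : HInfty | ∃ f, MemBergman p α f ∧ bergmanNorm p α f ≤ M ∧
      ∀ z : disc, (g : disc →ᵇ ℂ) z = weightedDiffComp k u φ f z} with hS
    have hcode (g : S) : ∃ f, (MemBergman p α f ∧ bergmanNorm p α f ≤ M ∧
        ∀ z : disc, (g : disc →ᵇ ℂ) z = weightedDiffComp k u φ f z) ∧
        ∃ y : t₂, ∀ i : t, ‖iteratedDeriv k f i - (y : t → ℂ) i‖ < η := by
      obtain ⟨f, hf⟩ := g.2
      have h1 : (fun i : t => iteratedDeriv k f i) ∈ Metric.closedBall (0 : t → ℂ) R := by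
        rw [mem_closedBall_zero_iff, pi_norm_le_iff_of_nonneg hR0]
        intro i
        obtain ⟨hi, hi'⟩ := hK (htK i.2)
        refine (hCf f hf.1.1 M hf.2.1 i hi).trans ?_
        rw [hR]
        gcongr
      obtain ⟨y, hy, hyb⟩ := mem_iUnion₂.1 (ht₂ h1)
      rw [Metric.mem_ball, dist_pi_lt_iff hη0] at hyb
      exact ⟨f, hf, ⟨y, hy⟩, fun i => by simpa [dist_eq_norm] using hyb i⟩
    choose F hF y hy using hcode
    refine ⟨t₂, inferInstance, y, fun g₁ g₂ h12 => ?_⟩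
    have hlip (g : S) {w v : ℂ} (hw : w ∈ Metric.closedBall (0 : ℂ) δ)
        (hv : v ∈ Metric.closedBall (0 : ℂ) δ) :
        ‖iteratedDeriv k (F g) w - iteratedDeriv k (F g) v‖ ≤ L * ‖w - v‖ := by
      refine (convex_closedBall (0 : ℂ) δ).norm_image_sub_le_of_norm_deriv_le
        (fun x hx => ?_) (fun x hx => ?_) hv hw
      · exact (differentiableOn_iteratedDeriv (hF g).1.1 k).differentiableAt
          (Metric.isOpen_ball.mem_nhds (hK hx).1)
      · rw [← iteratedDeriv_succ]
        refine (hCf' _ (hF g).1.1 M (hF g).2.1 x (hK hx).1).trans ?_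
        have h2 := (hK hx).2
        rw [hL]
        have : 0 ≤ (2 + α) / p := div_nonneg (by linarith) hp.le
        gcongr
    have hdist : dist (g₁ : HInfty) g₂ ≤ ε / 2 := by
      refine (BoundedContinuousFunction.dist_le (by positivity)).2 fun z => ?_
      rw [(hF g₁).2.2, (hF g₂).2.2, dist_eq_norm]
      rcases lt_or_ge δ ‖φ z‖ with h | h
      · have h1 := hnear hε'0 hδ (hF g₁).1.1 (hF g₁).2.1 z.2 h
        have h2 := hnear hε'0 hδ (hF g₂).1.1 (hF g₂).2.1 z.2 h
        have h3 : ε' * (2 ^ s * C * M) ≤ ε / 4 := by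
          have h0 : 0 ≤ 2 ^ s * C * M := by positivity
          rw [hε', div_mul_eq_mul_div, div_le_div_iff₀ (by positivity) (by norm_num)]
          nlinarith
        refine (norm_sub_le _ _).trans ?_
        linarith
      · have hφz : φ z ∈ Metric.closedBall (0 : ℂ) δ := by simpa using h
        obtain ⟨i, hi, hiz⟩ := mem_iUnion₂.1 (ht hφz)
        rw [Metric.mem_ball, dist_eq_norm] at hiz
        have h1 := hlip g₁ hφz (htK hi)
        have h2 := hlip g₂ (htK hi) hφz
        rw [norm_sub_rev i] at h2
        have h3 := hy g₁ ⟨i, hi⟩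
        have h4 := hy g₂ ⟨i, hi⟩
        rw [← h12, norm_sub_rev] at h4
        have h5 : L * ‖φ z - i‖ ≤ L * η := by gcongr
        -- Two moves from φ z to the net point cost Lη each, and two comparisons with the common
        -- code cost η each; η was chosen so that B times this sum is at most ε/2.
        have h6 : ‖iteratedDeriv k (F g₁) (φ z) - iteratedDeriv k (F g₂) (φ z)‖
            ≤ (2 * L + 2) * η := by
          have e : iteratedDeriv k (F g₁) (φ z) - iteratedDeriv k (F g₂) (φ z)
            = (iteratedDeriv k (F g₁) (φ z) - iteratedDeriv k (F g₁) i)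
              + (iteratedDeriv k (F g₁) i - (y g₁ : t → ℂ) ⟨i, hi⟩)
              + ((y g₁ : t → ℂ) ⟨i, hi⟩ - iteratedDeriv k (F g₂) i)
              + (iteratedDeriv k (F g₂) i - iteratedDeriv k (F g₂) (φ z)) := by ring
          rw [e]
          refine norm_add₄_le.trans ?_
          linarith
        rw [weightedDiffComp, weightedDiffComp, ← mul_sub, norm_mul]
        calc _ ≤ B * ((2 * L + 2) * η) :=
              mul_le_mul (huB z z.2) h6 (norm_nonneg _) hB
          _ ≤ ε / 2 := by
              have h0 : 0 ≤ B * (2 * L + 2) := by positivity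
              rw [← mul_assoc, hη, mul_div_assoc', div_le_div_iff₀ (by positivity) (by norm_num)]
              nlinarith
    linarith

theorem memHInfty_sum {n : ℕ} {g : Fin (n + 1) → ℂ → ℂ} (h : ∀ k, MemHInfty (g k)) :
    MemHInfty fun z => ∑ k, g k z := by
  choose hd B hB hg using fun k => memHInfty_iff.1 (h k)
  refine memHInfty_iff.2 ⟨DifferentiableOn.fun_sum fun k _ => hd k, ∑ k, B k,
    Finset.sum_nonneg fun k _ => hB k, fun z hz => ?_⟩
  exact norm_sum_le_of_le _ fun k _ => hg k z hz

/-- The image of a ball under the sum lies in the image, under addition, of the product of the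
compact closures belonging to the summands. -/
theorem isCompact_sumWeightedDiffComp {p α : ℝ} {n : ℕ} {u φ : Fin (n + 1) → ℂ → ℂ}
    (h : ∀ k : Fin (n + 1), IsCompactBergmanToHInfty p α (weightedDiffComp k (u k) (φ k))) :
    IsCompactBergmanToHInfty p α (sumWeightedDiffComp n u φ) := by
  refine ⟨fun f hf => memHInfty_sum fun k => (h k).1 f hf, fun M => ?_⟩
  have hK := (isCompact_univ_pi fun k : Fin (n + 1) => (h k).2 M).image
    (f := fun g => ∑ k, g k) (by fun_prop)
  refine hK.closure_of_subset ?_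
  rintro g ⟨f, hf, hM, hg⟩
  choose G hG using fun k => ((h k).1 f hf).exists_eq
  refine ⟨G, fun k _ => subset_closure ⟨f, hf, hM, hG k⟩, ?_⟩
  apply Subtype.ext
  ext z
  rw [hg z]
  simp [sumWeightedDiffComp, hG]

/-! ### Compactness implies norm convergence on locally null sequences -/

theorem tendsto_iteratedDeriv {f : ℕ → ℂ → ℂ} (hf : ∀ j, DifferentiableOn ℂ (f j) disc)
    (h : ∀ K ⊆ disc, IsCompact K → TendstoUniformlyOn f 0 atTop K) (k : ℕ) {w : ℂ} (hw : w ∈ disc) :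
    Tendsto (fun j => iteratedDeriv k (f j) w) atTop (𝓝 0) := by
  have key : TendstoLocallyUniformlyOn (fun j => iteratedDeriv k (f j)) 0 atTop disc := by
    induction k with
    | zero =>
      simpa [iteratedDeriv_zero] using!
        (tendstoLocallyUniformlyOn_iff_forall_isCompact Metric.isOpen_ball).2 h
    | succ k ih =>
      have h1 := ih.deriv (.of_forall fun j => differentiableOn_iteratedDeriv (hf j) k)
        Metric.isOpen_ball
      have h2 : deriv (0 : ℂ → ℂ) = 0 := by ext; simp
      rw [h2] at h1
      simpa only [iteratedDeriv_succ] using! h1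
  simpa using key.tendsto_at hw

/-- Every subsequence of the images has a norm convergent subsequence, whose limit must be 0 because
the images tend to 0 pointwise. -/
theorem tendsto_supNorm_of_isCompact {p α : ℝ} {n : ℕ} {u φ : Fin (n + 1) → ℂ → ℂ}
    (hφ : ∀ k, MapsTo (φ k) disc disc)
    (hT : IsCompactBergmanToHInfty p α (sumWeightedDiffComp n u φ)) {f : ℕ → ℂ → ℂ}
    (hf : ∀ j, MemBergman p α (f j)) {M : ℝ≥0} (hM : ∀ j, bergmanNorm p α (f j) ≤ M)
    (hlim : ∀ K ⊆ disc, IsCompact K → TendstoUniformlyOn f 0 atTop K) :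
    Tendsto (fun j => supNorm (sumWeightedDiffComp n u φ (f j))) atTop (𝓝 0) := by
  choose G hG using fun j => (hT.1 _ (hf j)).exists_eq
  have hG0 : Tendsto G atTop (𝓝 0) := by
    refine tendsto_of_subseq_tendsto fun ns hns => ?_
    obtain ⟨g, -, ms, hms, hg⟩ := (hT.2 M).tendsto_subseq (x := fun j => G (ns j))
      fun j => subset_closure ⟨_, hf _, hM _, hG _⟩
    refine ⟨ms, ?_⟩
    have hg0 : g = 0 := by
      apply Subtype.ext
      ext z
      have h1 : Tendsto (fun j => ((G (ns (ms j)) : HInfty) : disc →ᵇ ℂ) z) atTop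
          (𝓝 ((g : disc →ᵇ ℂ) z)) :=
        ((continuous_eval_const z).comp continuous_subtype_val).continuousAt.tendsto.comp hg
      have h2 : Tendsto (fun j => sumWeightedDiffComp n u φ (f j) z) atTop (𝓝 0) := by
        have : Tendsto (fun j => ∑ k : Fin (n + 1), u k z * iteratedDeriv k (f j) (φ k z)) atTop
            (𝓝 (∑ k : Fin (n + 1), u k z * 0)) :=
          tendsto_finsetSum _ fun k _ => (tendsto_iteratedDeriv (fun j => (hf j).1) hlim k
            (hφ k z.2)).const_mul _
        simpa using! this
      simp_rw [hG] at h1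
      exact tendsto_nhds_unique h1 (h2.comp (hns.comp hms.tendsto_atTop))
    rw [← hg0]
    exact hg
  have h1 : ∀ j, supNorm (sumWeightedDiffComp n u φ (f j)) = ‖G j‖ₑ :=
    fun j => supNorm_eq_enorm _ (hG j)
  simp_rw [h1, ← ofReal_norm]
  simpa only [norm_zero, ENNReal.ofReal_zero] using ENNReal.tendsto_ofReal hG0.norm

/-! ### Polynomials with prescribed iterates of X² d/dX -/

open Polynomial in
/-- The operator `X² d/dX`, which is differentiation with respect to `-1/X`. -/
noncomputable def sqDerivative : ℂ[X] →ₗ[ℂ] ℂ[X] := LinearMap.mulLeft ℂ (X ^ 2) ∘ₗ derivative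

section sqDerivative
open Polynomial

theorem sqDerivative_apply (P : ℂ[X]) : sqDerivative P = X ^ 2 * derivative P := rfl

theorem sqDerivative_pow_succ_apply (j : ℕ) (P : ℂ[X]) :
    (sqDerivative ^ (j + 1)) P = X ^ 2 * derivative ((sqDerivative ^ j) P) := by
  rw [pow_succ', Module.End.mul_apply, sqDerivative_apply]

/-- Each step loses one zero at the origin to the derivative and gains two from X². The surplus j
matches the growth of the exponent from γ to γ + j. -/
theorem X_pow_dvd_sqDerivative_pow {N : ℕ} {P : ℂ[X]} (h : X ^ N ∣ P) (j : ℕ) :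
    X ^ (N + j) ∣ (sqDerivative ^ j) P := by
  induction j with
  | zero => simpa using h
  | succ j ih =>
    rw [sqDerivative_pow_succ_apply]
    have h1 := mul_dvd_mul (dvd_refl (X ^ 2 : ℂ[X])) (pow_sub_one_dvd_derivative_of_pow_dvd ih)
    rw [← pow_add] at h1
    exact (pow_dvd_pow X (by omega)).trans h1

theorem X_sub_C_pow_dvd_sqDerivative_pow {ξ : ℂ} {m j : ℕ} {P : ℂ[X]} (h : (X - C ξ) ^ (m + j) ∣ P) :
    (X - C ξ) ^ m ∣ (sqDerivative ^ j) P := by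
  induction j generalizing m with
  | zero => simpa using h
  | succ j ih =>
    rw [sqDerivative_pow_succ_apply]
    exact Dvd.dvd.mul_left
      (pow_sub_one_dvd_derivative_of_pow_dvd (ih (m := m + 1) (by rwa [add_assoc, add_comm 1]))) _

theorem eval_sqDerivative_pow_eq_zero {ξ : ℂ} {m j : ℕ} (hj : j < m) {P : ℂ[X]}
    (h : (X - C ξ) ^ m ∣ P) : ((sqDerivative ^ j) P).eval ξ = 0 := by
  have h1 : (X - C ξ) ^ 1 ∣ (sqDerivative ^ j) P :=
    X_sub_C_pow_dvd_sqDerivative_pow ((pow_dvd_pow _ (by omega)).trans h)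
  rw [pow_one] at h1
  exact dvd_iff_isRoot.1 h1

/-- At 1 only the terms in which every derivative falls on the power of X - 1 survive, and X² is 1
there. -/
theorem eval_one_sqDerivative_pow (i : ℕ) (A : ℂ[X]) :
    ((sqDerivative ^ i) ((X - C 1) ^ i * A)).eval 1 = i.factorial * A.eval 1 := by
  induction i generalizing A with
  | zero => simp
  | succ i ih =>
    have h1 : sqDerivative ((X - C 1) ^ (i + 1) * A)
        = (X - C 1) ^ i * (X ^ 2 * (C ((i : ℂ) + 1) * A + (X - C 1) * derivative A)) := by
      rw [sqDerivative_apply, derivative_mul, derivative_X_sub_C_pow]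
      simp only [Nat.add_sub_cancel, Nat.cast_add, Nat.cast_one, map_add, map_natCast, map_one]
      ring
    rw [pow_succ, Module.End.mul_apply, h1, ih, Nat.factorial_succ]
    simp
    ring

/-- A triangular system: adding a multiple of (X - 1)^i A leaves the values of order below i at 1
unchanged and moves the value of order i by a nonzero amount, so the orders above k can be cleared
one at a time. -/
theorem exists_mul_sqDerivative_eval_one {A : ℂ[X]} (hA : A.eval 1 ≠ 0) (k m : ℕ) :
    ∃ B : ℂ[X], ((sqDerivative ^ k) (B * A)).eval 1 ≠ 0 ∧
      ∀ j ≤ k + m, j ≠ k → ((sqDerivative ^ j) (B * A)).eval 1 = 0 := by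
  induction m with
  | zero =>
    refine ⟨(X - C 1) ^ k, ?_, fun j hj hjk => ?_⟩
    · rw [eval_one_sqDerivative_pow]
      exact mul_ne_zero (by exact_mod_cast k.factorial_ne_zero) hA
    · exact eval_sqDerivative_pow_eq_zero (m := k) (by omega) (dvd_mul_right _ _)
  | succ m ih =>
    obtain ⟨B, hB, hB0⟩ := ih
    set i := k + m + 1 with hi
    set c : ℂ := ((sqDerivative ^ i) (B * A)).eval 1 / (i.factorial * A.eval 1) with hc
    have h1 (j : ℕ) : ((sqDerivative ^ j) ((B - c • (X - C 1) ^ i) * A)).eval 1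
        = ((sqDerivative ^ j) (B * A)).eval 1
          - c * ((sqDerivative ^ j) ((X - C 1) ^ i * A)).eval 1 := by
      rw [sub_mul, smul_mul_assoc, map_sub, map_smul, eval_sub, eval_smul, smul_eq_mul]
    have h2 (j : ℕ) (hj : j < i) : ((sqDerivative ^ j) ((X - C 1) ^ i * A)).eval 1 = 0 :=
      eval_sqDerivative_pow_eq_zero hj (dvd_mul_right _ _)
    refine ⟨B - c • (X - C 1) ^ i, ?_, fun j hj hjk => ?_⟩
    · rw [h1, h2 k (by omega), mul_zero, sub_zero]; exact hB
    · rw [h1]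
      rcases (show j ≤ i by omega).lt_or_eq with hlt | rfl
      · rw [h2 j hlt, hB0 j (by omega) hjk]; simp
      · rw [eval_one_sqDerivative_pow, hc, div_mul_cancel₀, sub_self]
        exact mul_ne_zero (by exact_mod_cast i.factorial_ne_zero) hA

theorem exists_polynomial_sqDerivative_eval {k n : ℕ} (hk : k ≤ n) (N : ℕ) (s : Finset ℂ) :
    ∃ P : ℂ[X], X ^ N ∣ P ∧ ((sqDerivative ^ k) P).eval 1 ≠ 0 ∧
      ∀ j ≤ n, j ≠ k → ∀ ξ ∈ s, ((sqDerivative ^ j) P).eval ξ = 0 := by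
  -- Zeros of order n + 1 survive up to n derivatives, which settles all points of s except 1; there
  -- B adjusts the values.
  set A : ℂ[X] := X ^ N * ∏ x ∈ s.erase 1, (X - C x) ^ (n + 1) with hA
  have hA1 : A.eval 1 ≠ 0 := by
    rw [hA, eval_mul, eval_prod]
    refine mul_ne_zero (by simp) (Finset.prod_ne_zero_iff.2 fun x hx => ?_)
    simpa using fun h => (Finset.mem_erase.1 hx).1 (sub_eq_zero.1 h).symm
  obtain ⟨B, hB, hB0⟩ := exists_mul_sqDerivative_eval_one hA1 k (n - k)
  refine ⟨B * A, (dvd_mul_right _ _).mul_left B, hB, fun j hj hjk ξ hξ => ?_⟩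
  by_cases h1 : ξ = 1
  · rw [h1]; exact hB0 j (by omega) hjk
  · refine eval_sqDerivative_pow_eq_zero (m := n + 1) (by omega) (Dvd.dvd.mul_left ?_ B)
    exact (Finset.dvd_prod_of_mem (fun x => (X - C x) ^ (n + 1))
      (Finset.mem_erase.2 ⟨h1, hξ⟩)).mul_left _

end sqDerivative

/-! ### Test functions -/

/-- The kernel `(1 - |a|²) / (1 - \bar a w)`. -/
noncomputable def discKernel (a w : ℂ) : ℂ := ((1 - ‖a‖ ^ 2 : ℝ) : ℂ) / (1 - conj a * w)

/-- The function `(1 - |a|²)^{-γ} P((1 - |a|²) / (1 - \bar a w))`, which concentrates near `a`. -/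
noncomputable def testFunction (P : ℂ[X]) (γ : ℝ) (a w : ℂ) : ℂ :=
  (((1 - ‖a‖ ^ 2) ^ (-γ) : ℝ) : ℂ) * P.eval (discKernel a w)

theorem one_sub_norm_sq_pos {a : ℂ} (ha : ‖a‖ < 1) : 0 < 1 - ‖a‖ ^ 2 := by
  nlinarith [norm_nonneg a]

theorem norm_discKernel {a : ℂ} (ha : ‖a‖ < 1) (w : ℂ) :
    ‖discKernel a w‖ = (1 - ‖a‖ ^ 2) / ‖1 - conj a * w‖ := by
  rw [discKernel, norm_div, Complex.norm_of_nonneg (one_sub_norm_sq_pos ha).le]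

theorem norm_discKernel_le_two {a w : ℂ} (ha : ‖a‖ < 1) (hw : ‖w‖ < 1) : ‖discKernel a w‖ ≤ 2 := by
  rw [norm_discKernel ha, div_le_iff₀ (norm_pos_iff.2 (one_sub_mul_ne_zero ha hw.le))]
  have := one_sub_norm_le_norm' (a := a) hw.le
  nlinarith [norm_nonneg a]

theorem norm_discKernel_le {a w : ℂ} (ha : ‖a‖ < 1) (hw : ‖w‖ < 1) :
    ‖discKernel a w‖ ≤ (1 - ‖a‖ ^ 2) / (1 - ‖w‖) := by
  rw [norm_discKernel ha]
  have h0 := (one_sub_norm_sq_pos ha).le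
  have h1 : 0 < 1 - ‖w‖ := by linarith
  gcongr
  exact one_sub_norm_le_norm ha.le

theorem discKernel_self {a : ℂ} (ha : ‖a‖ < 1) : discKernel a a = 1 := by
  have h : (((1 - ‖a‖ ^ 2 : ℝ)) : ℂ) = 1 - conj a * a := by
    rw [← Complex.normSq_eq_conj_mul_self, Complex.normSq_eq_norm_sq]; push_cast; ring
  rw [discKernel, h, div_self (one_sub_mul_ne_zero ha ha.le)]

theorem hasDerivAt_discKernel {a w : ℂ} (ha : ‖a‖ < 1) (hw : ‖w‖ < 1) :
    HasDerivAt (discKernel a) (conj a / ((1 - ‖a‖ ^ 2 : ℝ) : ℂ) * discKernel a w ^ 2) w := by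
  have h0 := one_sub_mul_ne_zero ha hw.le
  have h1 : (((1 - ‖a‖ ^ 2 : ℝ)) : ℂ) ≠ 0 := by exact_mod_cast (one_sub_norm_sq_pos ha).ne'
  have h2 : HasDerivAt (fun w : ℂ => 1 - conj a * w) (-(conj a * 1)) w :=
    ((hasDerivAt_id w).const_mul (conj a)).const_sub 1
  refine ((hasDerivAt_const w (((1 - ‖a‖ ^ 2 : ℝ)) : ℂ)).div h2 h0).congr_deriv ?_
  rw [discKernel]
  generalize (((1 - ‖a‖ ^ 2 : ℝ)) : ℂ) = A at *
  field_simp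
  ring

theorem hasDerivAt_eval_discKernel (P : ℂ[X]) {a w : ℂ} (ha : ‖a‖ < 1) (hw : ‖w‖ < 1) :
    HasDerivAt (fun w => P.eval (discKernel a w))
      (conj a / ((1 - ‖a‖ ^ 2 : ℝ) : ℂ) * (sqDerivative P).eval (discKernel a w)) w := by
  refine ((P.hasDerivAt (discKernel a w)).comp w (hasDerivAt_discKernel ha hw)).congr_deriv ?_
  rw [sqDerivative_apply, Polynomial.eval_mul, Polynomial.eval_pow, Polynomial.eval_X]
  ring

theorem differentiableOn_testFunction (P : ℂ[X]) (γ : ℝ) {a : ℂ} (ha : ‖a‖ < 1) :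
    DifferentiableOn ℂ (testFunction P γ a) disc := fun w hw =>
  ((hasDerivAt_eval_discKernel P ha (by simpa using hw)).const_mul _).differentiableAt
    |>.differentiableWithinAt

theorem iteratedDeriv_testFunction (P : ℂ[X]) (γ : ℝ) {a : ℂ} (ha : ‖a‖ < 1) (j : ℕ) :
    EqOn (iteratedDeriv j (testFunction P γ a)) (fun w => (((1 - ‖a‖ ^ 2) ^ (-γ) : ℝ) : ℂ) *
      ((conj a / ((1 - ‖a‖ ^ 2 : ℝ) : ℂ)) ^ j * ((sqDerivative ^ j) P).eval (discKernel a w))) disc := by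
  induction j with
  | zero => intro w _; simp [testFunction]
  | succ j ih =>
    intro w hw
    have h1 := (ih.eventuallyEq_of_mem (Metric.isOpen_ball.mem_nhds hw)).deriv_eq
    rw [iteratedDeriv_succ, h1]
    rw [(((hasDerivAt_eval_discKernel ((sqDerivative ^ j) P) ha
      (by simpa using hw)).const_mul _).const_mul _).deriv]
    rw [pow_succ' sqDerivative, Module.End.mul_apply]
    ring

theorem norm_iteratedDeriv_testFunction (P : ℂ[X]) (γ : ℝ) {a w : ℂ} (ha : ‖a‖ < 1) (hw : w ∈ disc)
    (j : ℕ) : ‖iteratedDeriv j (testFunction P γ a) w‖ = (1 - ‖a‖ ^ 2) ^ (-(γ + j)) *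
      (‖a‖ ^ j * ‖((sqDerivative ^ j) P).eval (discKernel a w)‖) := by
  have h0 := one_sub_norm_sq_pos ha
  rw [iteratedDeriv_testFunction P γ ha j hw]
  simp only [norm_mul, norm_pow, norm_div, RCLike.norm_conj, Complex.norm_of_nonneg h0.le]
  rw [Complex.norm_of_nonneg (by positivity), neg_add, Real.rpow_add h0, Real.rpow_neg h0.le (j : ℝ),
    Real.rpow_natCast, div_pow]
  ring

theorem exists_norm_eval_le {P : ℂ[X]} {N : ℕ} (hP : Polynomial.X ^ N ∣ P) :
    ∃ K : ℝ, 0 ≤ K ∧ ∀ x : ℂ, ‖x‖ ≤ 2 → ‖P.eval x‖ ≤ K * ‖x‖ ^ N := by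
  obtain ⟨R, rfl⟩ := hP
  obtain ⟨K, hK⟩ := (isCompact_closedBall (0 : ℂ) 2).exists_bound_of_continuousOn
    (f := fun x => R.eval x) R.continuous.continuousOn
  refine ⟨max K 0, le_max_right _ _, fun x hx => ?_⟩
  rw [Polynomial.eval_mul, Polynomial.eval_pow, Polynomial.eval_X, norm_mul, norm_pow, mul_comm]
  gcongr
  exact (hK x (by simpa using hx)).trans (le_max_left _ _)

/-- The test functions form a bounded subset of `A^p_α`. -/
theorem exists_bergmanNorm_testFunction_le {p α : ℝ} (hp : 0 < p) (hα : -1 ≤ α) {P : ℂ[X]} {N : ℕ}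
    (hP : Polynomial.X ^ N ∣ P) (hN : 2 * ((2 + α) / p) ≤ N) :
    ∃ M : ℝ≥0, ∀ a : ℂ, ‖a‖ < 1 → bergmanNorm p α (testFunction P ((2 + α) / p) a) ≤ M := by
  set γ : ℝ := (2 + α) / p with hγ
  have hγ0 : 0 ≤ γ := div_nonneg (by linarith) hp.le
  obtain ⟨C, hC⟩ := bergmanNorm_le_of_kernel hp hα
  obtain ⟨K, hK0, hK⟩ := exists_norm_eval_le hP
  have hK' : 0 ≤ K * 2 ^ (N - 2 * γ) := by positivity
  -- With x = `discKernel a w`, |x| ≤ 2 and N ≥ 2γ give |x|^N ≤ 2^(N-2γ) |x|^(2γ), and (1 -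
  -- |a|²)^(-γ) |x|^(2γ) is exactly the kernel to the power γ.
  refine ⟨⟨K * 2 ^ (N - 2 * γ), hK'⟩ * C, fun a ha => hC a ha _ _ fun w hw => ?_⟩
  have hw1 : ‖w‖ < 1 := by simpa using hw
  have hA := one_sub_norm_sq_pos ha
  have hD := norm_pos_iff.2 (one_sub_mul_ne_zero ha hw1.le)
  have hx2 := norm_discKernel_le_two ha hw1
  have hx0 : 0 < ‖discKernel a w‖ := by rw [norm_discKernel ha]; positivity
  rw [testFunction, norm_mul, Complex.norm_of_nonneg (by positivity)]
  change _ ≤ K * 2 ^ (N - 2 * γ) * ((1 - ‖a‖ ^ 2) / ‖1 - conj a * w‖ ^ 2) ^ γ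
  calc (1 - ‖a‖ ^ 2) ^ (-γ) * ‖P.eval (discKernel a w)‖
      ≤ (1 - ‖a‖ ^ 2) ^ (-γ) * (K * ‖discKernel a w‖ ^ N) := by
        gcongr; exact hK _ hx2
    _ = (1 - ‖a‖ ^ 2) ^ (-γ) * (K * (‖discKernel a w‖ ^ (N - 2 * γ) * ‖discKernel a w‖ ^ (2 * γ))) := by
        rw [← Real.rpow_add hx0, sub_add_cancel, Real.rpow_natCast]
    _ ≤ (1 - ‖a‖ ^ 2) ^ (-γ) * (K * (2 ^ (N - 2 * γ) * ‖discKernel a w‖ ^ (2 * γ))) := by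
        have : 0 ≤ N - 2 * γ := by linarith
        gcongr
    _ = _ := by
        have h1 : ‖discKernel a w‖ ^ (2 * γ)
            = (1 - ‖a‖ ^ 2) ^ γ * ((1 - ‖a‖ ^ 2) / ‖1 - conj a * w‖ ^ 2) ^ γ := by
          rw [Real.rpow_mul hx0.le, Real.rpow_two, ← Real.mul_rpow hA.le (by positivity),
            norm_discKernel ha]
          congr 1
          ring
        rw [h1, Real.rpow_neg hA.le]
        field_simp

/-- The test functions tend to `0` locally uniformly as `|a| → 1`. -/
theorem tendstoUniformlyOn_testFunction {γ : ℝ} {P : ℂ[X]} {N : ℕ} (hP : Polynomial.X ^ N ∣ P)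
    (hN : γ + 1 ≤ N) {a : ℕ → ℂ} (ha : ∀ m, ‖a m‖ < 1)
    (hlim : Tendsto (fun m => 1 - ‖a m‖ ^ 2) atTop (𝓝 0)) {S : Set ℂ} (hS : S ⊆ disc)
    (hSc : IsCompact S) : TendstoUniformlyOn (fun m => testFunction P γ (a m)) 0 atTop S := by
  obtain ⟨K, hK0, hK⟩ := exists_norm_eval_le hP
  obtain ⟨ρ, hρ1, hρ⟩ : ∃ ρ : ℝ, ρ < 1 ∧ ∀ w ∈ S, ‖w‖ ≤ ρ := by
    rcases S.eq_empty_or_nonempty with rfl | hne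
    · exact ⟨0, one_pos, by simp⟩
    · obtain ⟨w, hw, hmax⟩ := hSc.exists_isMaxOn hne continuous_norm.continuousOn
      exact ⟨‖w‖, by simpa using hS hw, fun v hv => hmax hv⟩
  have hbound : Tendsto (fun m => K / (1 - ρ) ^ N * (1 - ‖a m‖ ^ 2)) atTop (𝓝 0) := by
    simpa using hlim.const_mul (K / (1 - ρ) ^ N)
  rw [Metric.tendstoUniformlyOn_iff]
  intro ε hε
  filter_upwards [hbound.eventually (gt_mem_nhds hε)] with m hm w hw
  refine lt_of_le_of_lt ?_ hm
  have hA := one_sub_norm_sq_pos (ha m)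
  have hw1 : ‖w‖ < 1 := by simpa using hS hw
  have hρ' : 0 < 1 - ρ := by linarith
  rw [Pi.zero_apply, dist_zero_left, testFunction, norm_mul, Complex.norm_of_nonneg (by positivity)]
  have h1 : ‖discKernel (a m) w‖ ≤ (1 - ‖a m‖ ^ 2) / (1 - ρ) := by
    refine (norm_discKernel_le (ha m) hw1).trans ?_
    gcongr
    exact hρ w hw
  calc (1 - ‖a m‖ ^ 2) ^ (-γ) * ‖P.eval (discKernel (a m) w)‖
      ≤ (1 - ‖a m‖ ^ 2) ^ (-γ) * (K * ((1 - ‖a m‖ ^ 2) / (1 - ρ)) ^ N) := by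
        gcongr
        refine (hK _ (norm_discKernel_le_two (ha m) hw1)).trans ?_
        gcongr
    _ = K / (1 - ρ) ^ N * (1 - ‖a m‖ ^ 2) ^ (N - γ) := by
        rw [div_pow, sub_eq_neg_add (N : ℝ) γ, Real.rpow_add hA, Real.rpow_natCast]
        ring
    _ ≤ K / (1 - ρ) ^ N * (1 - ‖a m‖ ^ 2) ^ (1 : ℝ) := by
        refine mul_le_mul_of_nonneg_left ?_ (by positivity)
        exact Real.rpow_le_rpow_of_exponent_ge hA (by nlinarith [norm_nonneg (a m)]) (by linarith)
    _ = _ := by rw [Real.rpow_one]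

theorem exists_bergmanNorm_le_of_norm_le_one {p α : ℝ} (hp : 0 < p) (hα : -1 ≤ α) :
    ∃ M : ℝ≥0, ∀ f : ℂ → ℂ, (∀ w ∈ disc, ‖f w‖ ≤ 1) → bergmanNorm p α f ≤ M := by
  obtain ⟨C, hC⟩ := bergmanNorm_le_of_kernel hp hα
  exact ⟨1 * C, fun f hf => hC 0 (by simp) 1 f fun w hw => by simpa using hf w hw⟩

/-! ### Boundedness of the weights -/

/-- `T` maps bounded sequences that converge to `0` locally uniformly to sequences that converge to
`0` uniformly. -/
def TendstoSupNormZero (p α : ℝ) (T : (ℂ → ℂ) → ℂ → ℂ) : Prop :=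
  ∀ f : ℕ → ℂ → ℂ, (∀ j, MemBergman p α (f j)) → (∃ M : ℝ≥0, ∀ j, bergmanNorm p α (f j) ≤ M) →
    (∀ K ⊆ disc, IsCompact K → TendstoUniformlyOn f 0 atTop K) →
    Tendsto (fun j => supNorm (T (f j))) atTop (𝓝 0)

/-- The functions z^m/(j + 1) tend to 0 uniformly. Some image therefore has supremum below 1, which
by linearity bounds the image of z^m by j + 1. -/
theorem TendstoSupNormZero.exists_bound_pow {p α : ℝ} (hp : 0 < p) (hα : -1 ≤ α) {n : ℕ}
    {u φ : Fin (n + 1) → ℂ → ℂ} (h : TendstoSupNormZero p α (sumWeightedDiffComp n u φ)) (m : ℕ) :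
    ∃ B : ℝ, ∀ z ∈ disc, ‖sumWeightedDiffComp n u φ (fun z => z ^ m) z‖ ≤ B := by
  obtain ⟨M, hM⟩ := exists_bergmanNorm_le_of_norm_le_one hp hα
  have hle (j : ℕ) (w : ℂ) (hw : w ∈ disc) : ‖(((j : ℂ) + 1)⁻¹) * w ^ m‖ ≤ ((j : ℝ) + 1)⁻¹ := by
    have h1 : ‖(j : ℂ) + 1‖ = (j : ℝ) + 1 := by
      exact_mod_cast Complex.norm_natCast (j + 1)
    rw [norm_mul, norm_inv, h1, norm_pow]
    refine mul_le_of_le_one_right (by positivity) (pow_le_one₀ (norm_nonneg _) ?_)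
    have : ‖w‖ < 1 := by simpa using hw
    exact this.le
  have hle1 (j : ℕ) (w : ℂ) (hw : w ∈ disc) : ‖(((j : ℂ) + 1)⁻¹) * w ^ m‖ ≤ 1 :=
    (hle j w hw).trans (inv_le_one_of_one_le₀ (by linarith [(Nat.cast_nonneg j : (0 : ℝ) ≤ j)]))
  have h1 := h (fun j w => (((j : ℂ) + 1)⁻¹) * w ^ m)
    (fun j => ⟨by fun_prop, (hM _ (hle1 j)).trans_lt ENNReal.coe_lt_top⟩) ⟨M, fun j => hM _ (hle1 j)⟩
    (fun K hK _ => by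
      rw [Metric.tendstoUniformlyOn_iff]
      intro ε hε
      filter_upwards [(tendsto_one_div_add_atTop_nhds_zero_nat (𝕜 := ℝ)).eventually
        (gt_mem_nhds hε)] with j hj w hw
      rw [Pi.zero_apply, dist_zero_left]
      exact (hle j w (hK hw)).trans_lt (by simpa using hj))
  obtain ⟨j, hj⟩ := (h1.eventually (gt_mem_nhds one_pos)).exists
  refine ⟨(j : ℝ) + 1, fun z hz => ?_⟩
  have h2 : ‖sumWeightedDiffComp n u φ (fun w => (((j : ℂ) + 1)⁻¹) * w ^ m) z‖ₑ < 1 :=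
    lt_of_le_of_lt (le_iSup₂_of_le (f := fun z (_ : z ∈ disc) => ‖sumWeightedDiffComp n u φ
      (fun w => (((j : ℂ) + 1)⁻¹) * w ^ m) z‖ₑ) z hz le_rfl) hj
  have h3 : sumWeightedDiffComp n u φ (fun w => (((j : ℂ) + 1)⁻¹) * w ^ m) z
      = ((j : ℂ) + 1)⁻¹ * sumWeightedDiffComp n u φ (fun w => w ^ m) z := by
    simp only [sumWeightedDiffComp, weightedDiffComp, Finset.mul_sum]
    refine Finset.sum_congr rfl fun k _ => ?_
    rw [iteratedDeriv_const_mul_field]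
    ring
  have h4 : ‖(j : ℂ) + 1‖ = (j : ℝ) + 1 := by
    exact_mod_cast Complex.norm_natCast (j + 1)
  rw [h3, ← ofReal_norm, ENNReal.ofReal_lt_one, norm_mul, norm_inv, h4,
    inv_mul_lt_iff₀ (by positivity), mul_one] at h2
  exact h2.le

/-- Apply the operator to z^k: the terms with j > k vanish, those with j < k are bounded by
induction, and the term of index k is k! u_k. -/
theorem TendstoSupNormZero.memHInfty {p α : ℝ} (hp : 0 < p) (hα : -1 ≤ α) {n : ℕ}
    {u φ : Fin (n + 1) → ℂ → ℂ} (hu : ∀ k, DifferentiableOn ℂ (u k) disc)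
    (hφ : ∀ k, MapsTo (φ k) disc disc)
    (h : TendstoSupNormZero p α (sumWeightedDiffComp n u φ)) (k : Fin (n + 1)) :
    MemHInfty (u k) := by
  suffices hB : ∀ m : ℕ, ∀ k : Fin (n + 1), (k : ℕ) = m → ∃ B : ℝ, 0 ≤ B ∧ ∀ z ∈ disc, ‖u k z‖ ≤ B from
    memHInfty_iff.2 ⟨hu k, hB k k rfl⟩
  intro m
  induction m using Nat.strong_induction_on with
  | _ m ih =>
    intro k hk
    subst hk
    obtain ⟨B, hB⟩ := h.exists_bound_pow hp hα k
    have hterm (j : Fin (n + 1)) (hjk : j ≠ k) : ∃ C : ℝ, 0 ≤ C ∧ ∀ z ∈ disc,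
        ‖u j z * iteratedDeriv j (fun w => w ^ (k : ℕ)) (φ j z)‖ ≤ C := by
      rcases lt_or_gt_of_ne hjk with hlt | hgt
      · obtain ⟨C, hC0, hC⟩ := ih j hlt j rfl
        refine ⟨C * (k : ℕ).descFactorial j, by positivity, fun z hz => ?_⟩
        have h1 : ‖φ j z‖ < 1 := by simpa using hφ j hz
        rw [iteratedDeriv_pow, norm_mul, norm_mul, norm_pow, Complex.norm_natCast]
        gcongr
        · exact hC z hz
        · exact mul_le_of_le_one_right (by positivity) (pow_le_one₀ (norm_nonneg _) h1.le)
      · refine ⟨0, le_rfl, fun z _ => ?_⟩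
        rw [iteratedDeriv_pow, Nat.descFactorial_eq_zero_iff_lt.2 hgt]
        simp
    choose! C hC0 hC using hterm
    refine ⟨max (B + ∑ j ∈ Finset.univ.erase k, C j) 0, le_max_right _ _, fun z hz => ?_⟩
    refine le_trans ?_ (le_max_left _ _)
    have h1 : sumWeightedDiffComp n u φ (fun z => z ^ (k : ℕ)) z
        = u k z * (k : ℕ).factorial + ∑ j ∈ Finset.univ.erase k,
          u j z * iteratedDeriv j (fun w => w ^ (k : ℕ)) (φ j z) := by
      rw [sumWeightedDiffComp, ← Finset.add_sum_erase _ _ (Finset.mem_univ k)]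
      simp [weightedDiffComp, iteratedDeriv_pow, Nat.descFactorial_self]
    have h2 : ‖∑ j ∈ Finset.univ.erase k,
        u j z * iteratedDeriv j (fun w => w ^ (k : ℕ)) (φ j z)‖ ≤ ∑ j ∈ Finset.univ.erase k, C j :=
      norm_sum_le_of_le _ fun j hj => hC j (Finset.ne_of_mem_erase hj) z hz
    have h3 : u k z * (k : ℕ).factorial = sumWeightedDiffComp n u φ (fun z => z ^ (k : ℕ)) z
        - ∑ j ∈ Finset.univ.erase k, u j z * iteratedDeriv j (fun w => w ^ (k : ℕ)) (φ j z) := by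
      rw [h1]; ring
    have h4 : ‖u k z‖ ≤ ‖u k z * (k : ℕ).factorial‖ := by
      rw [norm_mul, Complex.norm_natCast]
      exact le_mul_of_one_le_right (norm_nonneg _) (by exact_mod_cast (k : ℕ).factorial_pos)
    refine h4.trans ?_
    rw [h3]
    exact (norm_sub_le _ _).trans (add_le_add (hB z hz) h2)

/-! ### Necessity of the decay condition -/

theorem IsCompact.exists_tendsto_ultrafilter {X Y : Type*} [TopologicalSpace Y] {K : Set Y}
    (hK : IsCompact K) (U : Ultrafilter X) {g : X → Y} (hg : ∀ᶠ z in (U : Filter X), g z ∈ K) :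
    ∃ b ∈ K, Tendsto g U (𝓝 b) :=
  hK.ultrafilter_le_nhds (U.map g) (le_principal_iff.2 hg)

/-- The negative power is harmful only if ξ = 0, and then the zero of order N > s of Q at the origin
absorbs it. -/
theorem tendsto_rpow_mul_norm_eval {X : Type*} {l : Filter X} {x : X → ℂ} {ξ : ℂ} {Q : ℂ[X]} {N : ℕ}
    {s : ℝ} (hQ : Polynomial.X ^ N ∣ Q) (hs : s < N) (hx : Tendsto x l (𝓝 ξ))
    (hx0 : ∀ᶠ z in l, x z ≠ 0) (hξ : Q.eval ξ = 0) :
    Tendsto (fun z => ‖x z‖ ^ (-s) * ‖Q.eval (x z)‖) l (𝓝 0) := by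
  obtain ⟨R, rfl⟩ := hQ
  have h1 : Tendsto (fun z => ‖x z‖ ^ (N - s) * ‖R.eval (x z)‖) l
      (𝓝 (‖ξ‖ ^ (N - s) * ‖R.eval ξ‖)) :=
    (hx.norm.rpow_const (Or.inr (by linarith))).mul (R.continuous.continuousAt.tendsto.comp hx).norm
  have h2 : ‖ξ‖ ^ (N - s) * ‖R.eval ξ‖ = 0 := by
    simp only [Polynomial.eval_mul, Polynomial.eval_pow, Polynomial.eval_X, mul_eq_zero] at hξ
    rcases hξ with h | h
    · rw [eq_zero_of_pow_eq_zero h, norm_zero, Real.zero_rpow (by linarith), zero_mul]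
    · rw [h, norm_zero, mul_zero]
  rw [h2] at h1
  refine h1.congr' ?_
  filter_upwards [hx0] with z hz
  have hz0 : 0 < ‖x z‖ := norm_pos_iff.2 hz
  rw [Polynomial.eval_mul, Polynomial.eval_pow, Polynomial.eval_X, norm_mul, norm_pow,
    sub_eq_neg_add, Real.rpow_add hz0, Real.rpow_natCast]
  ring

/-- The quotient `|u| / (1 - |φ|²)^s`. -/
noncomputable def growthQuotient (s : ℝ) (u φ : ℂ → ℂ) (z : ℂ) : ℝ :=
  ‖u z‖ / (1 - ‖φ z‖ ^ 2) ^ s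

theorem growthQuotient_nonneg {s : ℝ} {u φ : ℂ → ℂ} (hφ : MapsTo φ disc disc) {z : ℂ}
    (hz : z ∈ disc) : 0 ≤ growthQuotient s u φ z := by
  have := one_sub_norm_sq_pos (a := φ z) (by simpa using hφ hz)
  rw [growthQuotient]; positivity

/-- Along an ultrafilter on which one of the quotients stays away from `0` near the boundary, there
is such a quotient that dominates all the others. -/
theorem exists_dominant_quotient {n : ℕ} {u φ : Fin (n + 1) → ℂ → ℂ} {s : Fin (n + 1) → ℝ}
    (hφ : ∀ k, MapsTo (φ k) disc disc) (hu : ∀ k, MemHInfty (u k))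
    (U : Ultrafilter ℂ) (hU : ∀ᶠ z in (U : Filter ℂ), z ∈ disc) {ε : ℝ} (hε : 0 < ε)
    {k₀ : Fin (n + 1)} (hk₀ : Tendsto (fun z => ‖φ k₀ z‖) U (𝓝 1))
    (hq : ∀ᶠ z in (U : Filter ℂ), ε ≤ growthQuotient (s k₀) (u k₀) (φ k₀) z) :
    ∃ k, Tendsto (fun z => ‖φ k z‖) U (𝓝 1) ∧
      (∀ᶠ z in (U : Filter ℂ), ε ≤ growthQuotient (s k) (u k) (φ k) z) ∧
      ∃ Λ : Fin (n + 1) → ℝ, ∀ j, ∀ᶠ z in (U : Filter ℂ),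
        growthQuotient (s j) (u j) (φ j) z ≤ Λ j * growthQuotient (s k) (u k) (φ k) z := by
  classical
  have hb (j : Fin (n + 1)) : ∃ b ∈ Metric.closedBall (0 : ℂ) 1, Tendsto (φ j) U (𝓝 b) :=
    (isCompact_closedBall (0 : ℂ) 1).exists_tendsto_ultrafilter U <| by
      filter_upwards [hU] with z hz using Metric.ball_subset_closedBall (hφ j hz)
  choose b hb1 hb using hb
  have hb1' (j) : ‖b j‖ ≤ 1 := by simpa using hb1 j
  -- J collects the indices with |φ_j| → 1. An ultrafilter selects a single maximal index in J.
  -- Outside J the quotients are bounded, hence at most a multiple of the dominant one, which is at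
  -- least ε.
  set J : Finset (Fin (n + 1)) := Finset.univ.filter fun j => ‖b j‖ = 1 with hJ
  have hk₀J : k₀ ∈ J := by
    simpa [hJ] using tendsto_nhds_unique (hb k₀).norm hk₀
  have hmax : ∀ᶠ z in (U : Filter ℂ), ∃ k ∈ (J : Set (Fin (n + 1))), ∀ j ∈ J,
      growthQuotient (s j) (u j) (φ j) z ≤ growthQuotient (s k) (u k) (φ k) z :=
    .of_forall fun z => J.exists_max_image _ ⟨k₀, hk₀J⟩
  obtain ⟨k, hkJ, hk⟩ := (Ultrafilter.eventually_exists_mem_iff J.finite_toSet).1 hmax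
  have hkb : ‖b k‖ = 1 := by simpa [hJ] using hkJ
  have hεk : ∀ᶠ z in (U : Filter ℂ), ε ≤ growthQuotient (s k) (u k) (φ k) z := by
    filter_upwards [hk, hq] with z h1 h2 using h2.trans (h1 k₀ hk₀J)
  refine ⟨k, hkb ▸ (hb k).norm, hεk, ?_⟩
  suffices ∀ j, ∃ Λ : ℝ, ∀ᶠ z in (U : Filter ℂ),
      growthQuotient (s j) (u j) (φ j) z ≤ Λ * growthQuotient (s k) (u k) (φ k) z by
    choose Λ hΛ using this
    exact ⟨Λ, hΛ⟩
  intro j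
  by_cases hj : j ∈ J
  · exact ⟨1, by filter_upwards [hk] with z hz using by rw [one_mul]; exact hz j hj⟩
  · have hbj : ‖b j‖ < 1 := lt_of_le_of_ne (hb1' j) (by simpa [hJ] using hj)
    have hA := one_sub_norm_sq_pos hbj
    obtain ⟨-, B, hB, huB⟩ := memHInfty_iff.1 (hu j)
    have hlim : Tendsto (fun z => ((1 - ‖φ j z‖ ^ 2) ^ s j)⁻¹) U
        (𝓝 (((1 - ‖b j‖ ^ 2) ^ s j)⁻¹)) :=
      (((hb j).norm.pow 2).const_sub 1 |>.rpow_const (Or.inl hA.ne')).inv₀ (by positivity)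
    set L : ℝ := ((1 - ‖b j‖ ^ 2) ^ s j)⁻¹ + 1 with hL
    have hL0 : 0 ≤ L := by positivity
    refine ⟨B * L / ε, ?_⟩
    filter_upwards [hlim.eventually (gt_mem_nhds (lt_add_one _)), hU, hεk] with z h1 h2 h3
    have h4 := one_sub_norm_sq_pos (a := φ j z) (by simpa using hφ j h2)
    calc growthQuotient (s j) (u j) (φ j) z ≤ B * L := by
          rw [growthQuotient, div_eq_mul_inv]
          exact mul_le_mul (huB z h2) h1.le (by positivity) hB
      _ = B * L / ε * ε := by field_simp
      _ ≤ _ := by gcongr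

/-- The weight at a is exchanged for the weight at φ z through 1 - |φ z|² ≤ 2 |1 - ā φ z|, at the
price of a negative power of the kernel value. -/
theorem norm_term_testFunction_le {P : ℂ[X]} {γ : ℝ} (hγ : 0 ≤ γ) {a : ℂ} (ha : ‖a‖ < 1) {u φ : ℂ → ℂ}
    (hφ : MapsTo φ disc disc) {z : ℂ} (hz : z ∈ disc) (j : ℕ) :
    ‖weightedDiffComp j u φ (testFunction P γ a) z‖ ≤ growthQuotient (γ + j) u φ z *
      (2 ^ (γ + j) * (‖discKernel a (φ z)‖ ^ (-(γ + j)) *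
        ‖((sqDerivative ^ j) P).eval (discKernel a (φ z))‖)) := by
  have hw : ‖φ z‖ < 1 := by simpa using hφ hz
  have hA := one_sub_norm_sq_pos ha
  have hW := one_sub_norm_sq_pos hw
  have hD := norm_pos_iff.2 (one_sub_mul_ne_zero ha hw.le)
  have hs : 0 ≤ γ + j := by positivity
  have hx : (1 - ‖φ z‖ ^ 2) / (1 - ‖a‖ ^ 2) ≤ 2 / ‖discKernel a (φ z)‖ := by
    rw [norm_discKernel ha, div_div_eq_mul_div]
    gcongr
    have := one_sub_norm_le_norm (a := a) (w := φ z) ha.le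
    nlinarith [norm_nonneg (φ z)]
  have hx0 : 0 < ‖discKernel a (φ z)‖ := by rw [norm_discKernel ha]; positivity
  have h1 := Real.rpow_le_rpow (by positivity) hx hs
  rw [Real.div_rpow hW.le hA.le, Real.div_rpow zero_le_two hx0.le] at h1
  rw [weightedDiffComp, norm_mul, norm_iteratedDeriv_testFunction P γ ha (hφ hz)]
  set E := ‖((sqDerivative ^ j) P).eval (discKernel a (φ z))‖ with hE
  have haj : ‖a‖ ^ j ≤ 1 := pow_le_one₀ (norm_nonneg a) ha.le
  calc ‖u z‖ * ((1 - ‖a‖ ^ 2) ^ (-(γ + j)) * (‖a‖ ^ j * E))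
      ≤ ‖u z‖ * ((1 - ‖a‖ ^ 2) ^ (-(γ + j)) * (1 * E)) := by gcongr
    _ = growthQuotient (γ + j) u φ z *
        ((1 - ‖φ z‖ ^ 2) ^ (γ + j) / (1 - ‖a‖ ^ 2) ^ (γ + j) * E) := by
        rw [growthQuotient, Real.rpow_neg hA.le]
        field_simp
    _ ≤ growthQuotient (γ + j) u φ z * (2 ^ (γ + j) / ‖discKernel a (φ z)‖ ^ (γ + j) * E) := by
        have := growthQuotient_nonneg (s := γ + j) (u := u) hφ hz
        gcongr
    _ = _ := by rw [Real.rpow_neg hx0.le]; ring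

theorem norm_term_testFunction_self {P : ℂ[X]} {γ : ℝ} {u φ : ℂ → ℂ}
    (hφ : MapsTo φ disc disc) {z : ℂ} (hz : z ∈ disc) (k : ℕ) :
    ‖weightedDiffComp k u φ (testFunction P γ (φ z)) z‖ = growthQuotient (γ + k) u φ z *
      (‖φ z‖ ^ k * ‖((sqDerivative ^ k) P).eval 1‖) := by
  have hw : ‖φ z‖ < 1 := by simpa using hφ hz
  have hW := one_sub_norm_sq_pos hw
  rw [weightedDiffComp, norm_mul, norm_iteratedDeriv_testFunction P γ hw (hφ hz),
    discKernel_self hw, growthQuotient, Real.rpow_neg hW.le]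
  ring

/-- Test functions detect a dominant quotient. -/
theorem exists_testFunction_lower_bound {n : ℕ} {u φ : Fin (n + 1) → ℂ → ℂ} {γ : ℝ} (hγ : 0 ≤ γ)
    (hφ : ∀ k, MapsTo (φ k) disc disc) {N : ℕ} (hN : γ < N)
    (U : Ultrafilter ℂ) (hU : ∀ᶠ z in (U : Filter ℂ), z ∈ disc) {ε : ℝ} (hε : 0 < ε)
    {k : Fin (n + 1)} (hk : Tendsto (fun z => ‖φ k z‖) U (𝓝 1))
    (hq : ∀ᶠ z in (U : Filter ℂ), ε ≤ growthQuotient (γ + (k : ℕ)) (u k) (φ k) z)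
    {Λ : Fin (n + 1) → ℝ} (hΛ : ∀ j : Fin (n + 1), ∀ᶠ z in (U : Filter ℂ),
      growthQuotient (γ + (j : ℕ)) (u j) (φ j) z
        ≤ Λ j * growthQuotient (γ + (k : ℕ)) (u k) (φ k) z) :
    ∃ P : ℂ[X], Polynomial.X ^ N ∣ P ∧ ∃ c : ℝ, 0 < c ∧ ∀ᶠ z in (U : Filter ℂ),
      c ≤ ‖sumWeightedDiffComp n u φ (testFunction P γ (φ k z)) z‖ := by
  classical
  have hφ1 (j : Fin (n + 1)) : ∀ᶠ z in (U : Filter ℂ), ‖φ j z‖ < 1 := by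
    filter_upwards [hU] with z hz using by simpa using hφ j hz
  have hx (j : Fin (n + 1)) : ∃ ξ ∈ Metric.closedBall (0 : ℂ) 2,
      Tendsto (fun z => discKernel (φ k z) (φ j z)) U (𝓝 ξ) :=
    (isCompact_closedBall (0 : ℂ) 2).exists_tendsto_ultrafilter U <| by
      filter_upwards [hφ1 j, hφ1 k] with z hj hk
      simpa using norm_discKernel_le_two hk hj
  choose ξ _ hξ using hx
  -- The polynomial depends only on the limits ξ, so it is the same for all z. Asking for zeros at
  -- every ξ, not only at ξ j for the order j, is harmless.
  obtain ⟨P, hPN, hPk, hP⟩ := exists_polynomial_sqDerivative_eval (Nat.lt_succ_iff.1 k.2) N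
    (Finset.univ.image ξ)
  set e : Fin (n + 1) → ℂ → ℝ := fun j z => 2 ^ (γ + (j : ℕ)) *
    (‖discKernel (φ k z) (φ j z)‖ ^ (-(γ + (j : ℕ))) *
      ‖((sqDerivative ^ (j : ℕ)) P).eval (discKernel (φ k z) (φ j z))‖) with he
  have he0 (j : Fin (n + 1)) (hj : j ≠ k) : Tendsto (e j) U (𝓝 0) := by
    rw [← mul_zero ((2 : ℝ) ^ (γ + (j : ℕ)))]
    refine (tendsto_rpow_mul_norm_eval (X_pow_dvd_sqDerivative_pow hPN j) (by push_cast; linarith)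
      (hξ j) ?_ (hP j (Nat.lt_succ_iff.1 j.2) (fun h => hj (Fin.ext h)) _
        (Finset.mem_image_of_mem _ (Finset.mem_univ j)))).const_mul _
    filter_upwards [hφ1 j, hφ1 k] with z hj hk
    rw [← norm_pos_iff, norm_discKernel hk]
    exact div_pos (one_sub_norm_sq_pos hk) (norm_pos_iff.2 (one_sub_mul_ne_zero hk hj.le))
  set c₀ : ℝ := ‖((sqDerivative ^ (k : ℕ)) P).eval 1‖ with hc₀
  have hc₀0 : 0 < c₀ := norm_pos_iff.2 hPk
  -- Relative to the dominant quotient, the k-th term tends to c₀ and the others to 0, so together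
  -- they eventually exceed c₀/2.
  have hlim : Tendsto (fun z => ‖φ k z‖ ^ (k : ℕ) * c₀ - ∑ j ∈ Finset.univ.erase k, Λ j * e j z) U
      (𝓝 (1 ^ (k : ℕ) * c₀ - ∑ j ∈ Finset.univ.erase k, Λ j * 0)) :=
    ((hk.pow _).mul_const _).sub (tendsto_finsetSum _ fun j hj =>
      (he0 j (Finset.ne_of_mem_erase hj)).const_mul _)
  simp only [one_pow, one_mul, mul_zero, Finset.sum_const_zero, sub_zero] at hlim
  refine ⟨P, hPN, ε * (c₀ / 2), by positivity, ?_⟩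
  filter_upwards [hlim.eventually (lt_mem_nhds (half_lt_self hc₀0)), hU, hq, hφ1 k,
    eventually_all.2 hΛ] with z h1 hz h2 h3 h4
  have hT : sumWeightedDiffComp n u φ (testFunction P γ (φ k z)) z
      = weightedDiffComp k (u k) (φ k) (testFunction P γ (φ k z)) z
        + ∑ j ∈ Finset.univ.erase k, weightedDiffComp j (u j) (φ j) (testFunction P γ (φ k z)) z := by
    rw [sumWeightedDiffComp, ← Finset.add_sum_erase _ _ (Finset.mem_univ k)]
  have hsum : ‖∑ j ∈ Finset.univ.erase k,
      weightedDiffComp j (u j) (φ j) (testFunction P γ (φ k z)) z‖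
      ≤ growthQuotient (γ + (k : ℕ)) (u k) (φ k) z * ∑ j ∈ Finset.univ.erase k, Λ j * e j z := by
    rw [Finset.mul_sum]
    refine norm_sum_le_of_le _ fun j hj => ?_
    refine (norm_term_testFunction_le hγ h3 (hφ j) hz j).trans ?_
    have he' : 0 ≤ e j z := by simp only [he]; positivity
    refine (mul_le_mul_of_nonneg_right (h4 j) he').trans_eq ?_
    ring
  have hself := norm_term_testFunction_self (P := P) (γ := γ) (u := u k) (hφ k) hz k
  have htri := norm_sub_le_norm_add (weightedDiffComp k (u k) (φ k) (testFunction P γ (φ k z)) z)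
    (∑ j ∈ Finset.univ.erase k, weightedDiffComp j (u j) (φ j) (testFunction P γ (φ k z)) z)
  rw [← hT, hself] at htri
  calc ε * (c₀ / 2) ≤ growthQuotient (γ + (k : ℕ)) (u k) (φ k) z *
        (‖φ k z‖ ^ (k : ℕ) * c₀ - ∑ j ∈ Finset.univ.erase k, Λ j * e j z) :=
        mul_le_mul h2 h1.le (by positivity) (hε.le.trans h2)
    _ ≤ _ := by rw [mul_sub]; linarith

theorem TendstoSupNormZero.tendsto_growthQuotient {p α : ℝ} (hp : 0 < p) (hα : -1 ≤ α) {n : ℕ}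
    {u φ : Fin (n + 1) → ℂ → ℂ} (hφ : ∀ k, MapsTo (φ k) disc disc) (hu : ∀ k, MemHInfty (u k))
    (h : TendstoSupNormZero p α (sumWeightedDiffComp n u φ)) (k₀ : Fin (n + 1)) :
    Tendsto (growthQuotient ((2 + α) / p + (k₀ : ℕ)) (u k₀) (φ k₀)) (towardBoundary (φ k₀)) (𝓝 0) := by
  set γ : ℝ := (2 + α) / p with hγ
  have hγ0 : 0 ≤ γ := div_nonneg (by linarith) hp.le
  by_contra hcon
  rw [Metric.tendsto_nhds] at hcon
  push Not at hcon
  obtain ⟨ε, hε, hfreq⟩ := hcon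
  have : NeBot (towardBoundary (φ k₀) ⊓
      𝓟 {z | ε ≤ dist (growthQuotient (γ + (k₀ : ℕ)) (u k₀) (φ k₀) z) 0}) :=
    frequently_mem_iff_neBot.1 hfreq
  -- Along an ultrafilter all the limits needed later exist at once, which replaces repeated passage
  -- to subsequences.
  obtain ⟨U, hU⟩ := Ultrafilter.exists_le (towardBoundary (φ k₀) ⊓
      𝓟 {z | ε ≤ dist (growthQuotient (γ + (k₀ : ℕ)) (u k₀) (φ k₀) z) 0})
  have hU1 := hU.trans inf_le_left
  have hUdisc : ∀ᶠ z in (U : Filter ℂ), z ∈ disc :=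
    le_principal_iff.1 (hU1.trans inf_le_right)
  have hUlim : Tendsto (fun z => ‖φ k₀ z‖) U (𝓝 1) :=
    tendsto_comap.mono_left (hU1.trans inf_le_left)
  have hUq : ∀ᶠ z in (U : Filter ℂ), ε ≤ growthQuotient (γ + (k₀ : ℕ)) (u k₀) (φ k₀) z := by
    filter_upwards [le_principal_iff.1 (hU.trans inf_le_right), hUdisc] with z hz hzd
    rwa [Real.dist_0_eq_abs, abs_of_nonneg (growthQuotient_nonneg (hφ k₀) hzd)] at hz
  obtain ⟨k, hk, hkq, Λ, hΛ⟩ := exists_dominant_quotient (s := fun j => γ + (j : ℕ)) hφ hu U hUdisc hε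
    hUlim hUq
  -- This N serves three purposes: N ≥ 2γ for norm boundedness, N ≥ γ + 1 for local uniform
  -- convergence, and N > γ for the lower bound.
  obtain ⟨N, hN⟩ := exists_nat_ge (2 * γ + 1)
  obtain ⟨P, hPN, c, hc, hP⟩ := exists_testFunction_lower_bound hγ0 hφ (N := N) (by linarith) U hUdisc hε
    hk hkq hΛ
  -- Condition (b) concerns sequences, so points with |φ_k| → 1 are extracted from the ultrafilter;
  -- k need not be the index k₀ at which decay was assumed to fail.
  have hseq (m : ℕ) : ∃ z ∈ disc, 1 - ‖φ k z‖ ^ 2 < 1 / ((m : ℝ) + 1) ∧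
      c ≤ ‖sumWeightedDiffComp n u φ (testFunction P γ (φ k z)) z‖ := by
    have h1 : Tendsto (fun z => 1 - ‖φ k z‖ ^ 2) U (𝓝 0) := by
      simpa using (hk.pow 2).const_sub 1
    exact (hUdisc.and ((h1.eventually (gt_mem_nhds (by positivity))).and hP)).exists
  choose z hz hz1 hzc using hseq
  have ha (m : ℕ) : ‖φ k (z m)‖ < 1 := by simpa using hφ k (hz m)
  have hlim : Tendsto (fun m => 1 - ‖φ k (z m)‖ ^ 2) atTop (𝓝 0) :=
    squeeze_zero (fun m => (one_sub_norm_sq_pos (ha m)).le) (fun m => (hz1 m).le)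
      tendsto_one_div_add_atTop_nhds_zero_nat
  obtain ⟨M, hM⟩ := exists_bergmanNorm_testFunction_le hp hα hPN (by linarith)
  have hfin := h (fun m => testFunction P γ (φ k (z m)))
    (fun m => ⟨differentiableOn_testFunction P γ (ha m), (hM _ (ha m)).trans_lt ENNReal.coe_lt_top⟩)
    ⟨M, fun m => hM _ (ha m)⟩
    (fun K hK hKc => tendstoUniformlyOn_testFunction hPN (by linarith) ha hlim hK hKc)
  obtain ⟨m, hm⟩ := (hfin.eventually (gt_mem_nhds (ENNReal.ofReal_pos.2 hc))).exists
  refine absurd hm (not_lt.2 ?_)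
  calc ENNReal.ofReal c ≤ ENNReal.ofReal
        ‖sumWeightedDiffComp n u φ (testFunction P γ (φ k (z m))) (z m)‖ :=
        ENNReal.ofReal_le_ofReal (hzc m)
    _ = ‖sumWeightedDiffComp n u φ (testFunction P γ (φ k (z m))) (z m)‖ₑ := ofReal_norm _
    _ ≤ _ := le_iSup₂_of_le (f := fun w (_ : w ∈ disc) =>
        ‖sumWeightedDiffComp n u φ (testFunction P γ (φ k (z m))) w‖ₑ) (z m) (hz m) le_rfl

end

theorem theorem2 (p α : ℝ) (hp : 0 < p) (hα : -1 ≤ α) (n : ℕ) (hn : 1 ≤ n)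
    (u φ : Fin (n + 1) → ℂ → ℂ)
    (hu : ∀ k, DifferentiableOn ℂ (u k) disc)
    (hφ : ∀ k, DifferentiableOn ℂ (φ k) disc)
    (hφ_maps : ∀ k, MapsTo (φ k) disc disc) :
    [ -- (a) `T : A^p_α → H^∞` is compact
      IsCompactBergmanToHInfty p α (sumWeightedDiffComp n u φ),
      -- (b) `‖T f_j‖_∞ → 0` for bounded sequences converging to `0` uniformly on compact sets
      ∀ f : ℕ → ℂ → ℂ, (∀ j, MemBergman p α (f j)) →
        (∃ M : ℝ≥0, ∀ j, bergmanNorm p α (f j) ≤ M) →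
        (∀ K ⊆ disc, IsCompact K → TendstoUniformlyOn f 0 atTop K) →
        Tendsto (fun j => supNorm (sumWeightedDiffComp n u φ (f j))) atTop (𝓝 0),
      -- (c) the condition on the symbols
      (∀ k, MemHInfty (u k)) ∧
        ∀ k : Fin (n + 1),
          Tendsto (fun z => ‖u k z‖ / (1 - ‖φ k z‖ ^ 2) ^ ((2 + α) / p + (k : ℝ)))
            (towardBoundary (φ k)) (𝓝 0),
      -- (d) each summand is compact
      ∀ k : Fin (n + 1), IsCompactBergmanToHInfty p α (weightedDiffComp k (u k) (φ k))
    ].TFAE := by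
  tfae_have 1 → 2 := fun h f hf ⟨_, hM⟩ hlim => tendsto_supNorm_of_isCompact hφ_maps h hf hM hlim
  tfae_have 2 → 3 := fun h =>
    have hb : TendstoSupNormZero p α (sumWeightedDiffComp n u φ) := h
    have hu' := hb.memHInfty hp hα hu hφ_maps
    ⟨hu', hb.tendsto_growthQuotient hp hα hφ_maps hu'⟩
  tfae_have 3 → 4 := fun h k =>
    isCompact_weightedDiffComp hp hα (hφ k) (hφ_maps k) (h.1 k) (h.2 k)
  tfae_have 4 → 1 := isCompact_sumWeightedDiffComp
  tfae_finish
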